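/- **Setting.** Let $0<|q|<1$ (either sign), $\theta=\tanh^{-1}q$, and for real $k$ let $\mu=\mu(k)=\sqrt{k^2+2}$. Write $s=\operatorname{sech}(x+\operatorname{sgn}(x)\theta)$, $t_x=\tanh(x+\operatorname{sgn}(x)\theta)$. For $k\in\mathbb R\setminus\{0\}$ let $$\psi(x,k)=\begin{bmatrix}(t_x-ik)^2\\-s^2\end{bmatrix}e^{ik(x-\theta)}+A\begin{bmatrix}-s^2\\(t_x-\mu)^2\end{bmatrix}e^{\mu(x-\theta)}\qquad(x<0),$$ $$\psi(x,k)=B\begin{bmatrix}(t_x-ik)^2\\-s^2\end{bmatrix}e^{ik(x+\theta)}+C\begin{bmatrix}(t_x+ik)^2\\-s^2\end{bmatrix}e^{-ik(x+\theta)}+D\begin{bmatrix}-s^2\\(t_x+\mu)^2\end{bmatrix}e^{-\mu(x+\theta)}\qquad(x>0),$$ where the coefficients $A,B,C,D$ (functions of $k$ and $q$), which make $\psi$ continuous at $x=0$ with $\psi'(0-)-\psi'(0+)=2q\,\psi(0)$, are, with $P=1+q^2(-2+k^2+2q^2)+2q(k^2+q^2)\mu+(k^2+q^2)\mu^2$,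 $$A=-\frac{2e^{(-ik+\mu)\theta}q(ik+q)(q^2-1)}{P},\qquad D=-A,$$ $$B=\frac{e^{-2ik\theta}(k-iq)\,\bigl(i+k(q+\mu)-iq(2q+\mu)\bigr)\bigl(k(q+\mu)-i(1+q\mu)\bigr)}{kP},$$ $$C=-\frac{iq\,\bigl(-1+(2+k^2)q^2+2q(k^2+q^2)\mu+(k^2+q^2)\mu^2\bigr)}{kP}.$$ Define $a(x,k),b(x,k)$ by $$\begin{bmatrix}a(x,k)\\b(x,k)\end{bmatrix}=v_+(x,k)=\begin{cases}\dfrac{\psi(-x,-k)}{(1+ik)^2B(-k)},&k>0,\\[2mm]\dfrac{\psi(x,k)}{(1-ik)^2B(k)},&k<0,\end{cases}$$ let $a_{\rm ev}(x,k)=\tfrac12(a(x,k)+a(-x,k))$, $b_{\rm ev}(x,k)=\tfrac12(b(x,k)+b(-x,k))$, and for $w_0:\mathbb R\to\mathbb R$ put $$f(k)=\frac{2}{\sqrt{2\pi}}\int_0^\infty\bigl(\overline{a_{\rm ev}(x,k)}-\overline{b_{\rm ev}(x,k)}\bigr)w_0(x)\,dx,$$ $$w(0,t)=\sqrt{\frac2\pi}\int_0^\infty\bigl(a(0,k)e^{-\frac12it(1+k^2)}+b(0,k)e^{\frac12it(1+k^2)}\bigr)f(k)\,dk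 .$$ **Proposition.** There is $q_0\in(0,1)$ such that for every family of constants $(C_{kl})_{k,l\in\mathbb N}$ there is $K>0$ with the following property. Let $0<|q|<q_0$ and let $w_0$ be real valued, even and smooth on $(0,\infty)$, with $$\|x^k\partial_x^lw_0\|_{L^\infty((0,\infty))}\le C_{kl}|q|\qquad\text{for all }k,l\in\mathbb N .$$ Then $w_0$ is integrable, the integrals defining $f(k)$ for $k>0$ and $w(0,t)$ for $t\ge1$ converge absolutely, and for all $t\ge1$ $$\left|\,w(0,t)+\frac{1}{\sqrt{2\pi t}}\,e^{it/2+i\pi/4}\int_{\mathbb R}w_0(x)\,dx\,\right|\le K\left(\frac{|q|}{t^{3/2}}+q^2\right),$$ that is, $w(0,t)=-\sqrt{\tfrac{2}{\pi t}}\,e^{it/2+i\pi/4}\int_0^\infty w_0\,dx+O(q/t^{3/2})+O(q^2)$. -/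

import Mathlib

open MeasureTheory Set
open scoped ComplexConjugate ContDiff

noncomputable section

namespace DeltaNLS

/-- The hyperbolic secant. -/
def sech (x : ℝ) : ℝ := (Real.cosh x)⁻¹

/-- The shift `θ = tanh⁻¹ q`. -/
def theta (q : ℝ) : ℝ := Real.artanh q

/-- `μ(k) = (k² + 2)^{1/2} > 0`. -/
def mu (k : ℝ) : ℝ := √(k ^ 2 + 2)

/-- The common real denominator of the scattering coefficients. -/
def den (q k : ℝ) : ℝ :=
  1 + q ^ 2 * (-2 + k ^ 2 + 2 * q ^ 2) + 2 * q * (k ^ 2 + q ^ 2) * mu k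
    + (k ^ 2 + q ^ 2) * mu k ^ 2

/-- The scattering coefficient `A(k)`. -/
def coefA (q k : ℝ) : ℂ :=
  -(2 * Complex.exp ((-(Complex.I * k) + mu k) * theta q) * q * (Complex.I * k + q)
      * (-1 + q ^ 2)) / den q k

/-- The scattering coefficient `B(k)`, for `k ≠ 0`. -/
def coefB (q k : ℝ) : ℂ :=
  Complex.exp (-(2 * Complex.I * k * theta q)) * (k - Complex.I * q)
      * (Complex.I + k * (q + mu k) - Complex.I * q * (2 * q + mu k))
      * (k * (q + mu k) - Complex.I * (1 + q * mu k))
    / (k * den q k)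

/-- The scattering coefficient `C(k)`, for `k ≠ 0`. -/
def coefC (q k : ℝ) : ℂ :=
  -(Complex.I * q * (-1 + (2 + k ^ 2) * q ^ 2 + 2 * q * (k ^ 2 + q ^ 2) * mu k
      + (k ^ 2 + q ^ 2) * mu k ^ 2))
    / (k * den q k)

/-- The scattering coefficient `D(k)`. -/
def coefD (q k : ℝ) : ℂ :=
  2 * Complex.exp ((-(Complex.I * k) + mu k) * theta q) * q * (Complex.I * k + q)
      * (-1 + q ^ 2) / den q k

/-- The expression of the generalized eigenfunction `ψ(x, k)` on the half line `x < 0`, where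
`x + sgn(x) θ = x - θ`. -/
def psiLeft (q x k : ℝ) : Fin 2 → ℂ :=
  let t : ℂ := Real.tanh (x - theta q)
  let s : ℂ := sech (x - theta q)
  Complex.exp (Complex.I * k * (x - theta q)) • ![(t - Complex.I * k) ^ 2, -s ^ 2]
    + (coefA q k * Complex.exp (mu k * (x - theta q))) • ![-s ^ 2, (t - mu k) ^ 2]

/-- The expression of the generalized eigenfunction `ψ(x, k)` on the half line `x > 0`, where
`x + sgn(x) θ = x + θ`. -/
def psiRight (q x k : ℝ) : Fin 2 → ℂ :=
  let t : ℂ := Real.tanh (x + theta q)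
  let s : ℂ := sech (x + theta q)
  (coefB q k * Complex.exp (Complex.I * k * (x + theta q))) •
      ![(t - Complex.I * k) ^ 2, -s ^ 2]
    + (coefC q k * Complex.exp (-(Complex.I * k * (x + theta q)))) •
      ![(t + Complex.I * k) ^ 2, -s ^ 2]
    + (coefD q k * Complex.exp (-(mu k * (x + theta q)))) • ![-s ^ 2, (t + mu k) ^ 2]

/-- The generalized eigenfunction `ψ(x, k)`, `H_q ψ = (1 + k²) ψ`, for real `k ≠ 0`. The two
expressions agree at `x = 0`, see `psi_continuity`. -/
def psi (q x k : ℝ) : Fin 2 → ℂ :=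
  if x ≤ 0 then psiLeft q x k else psiRight q x k

theorem mu_sq (k : ℝ) : mu k ^ 2 = k ^ 2 + 2 := Real.sq_sqrt (by positivity)

theorem mu_pos (k : ℝ) : 0 < mu k := Real.sqrt_pos.2 (by positivity)

theorem den_pos {q : ℝ} (hq : |q| < 1) (k : ℝ) : 0 < den q k := by
  have h : den q k = (1 - q ^ 2) ^ 2 + (k ^ 2 + q ^ 2) * (mu k + q) ^ 2 := by
    unfold den; ring
  have h1 : 0 < 1 - q ^ 2 := by
    have := (sq_lt_one_iff_abs_lt_one q).2 hq
    linarith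
  rw [h]; positivity

theorem tanh_theta {q : ℝ} (hq : |q| < 1) : Real.tanh (theta q) = q :=
  Real.tanh_artanh (abs_lt.1 hq)

theorem sech_sq (x : ℝ) : sech x ^ 2 = 1 - Real.tanh x ^ 2 := by
  have := Real.cosh_pos x
  have h := Real.cosh_sq x
  rw [sech, Real.tanh_eq_sinh_div_cosh]
  field_simp
  linarith

theorem sech_neg (x : ℝ) : sech (-x) = sech x := by simp [sech]

theorem exp_aux1 (q k : ℝ) : Complex.exp (-(2 * Complex.I * k * theta q))
    = (Complex.exp (Complex.I * k * theta q))⁻¹ ^ 2 := by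
  rw [← Complex.exp_neg, ← Complex.exp_nat_mul]; congr 1; push_cast; ring

theorem exp_aux2 (q k : ℝ) : Complex.exp ((-(Complex.I * k) + mu k) * theta q)
    = Complex.exp (mu k * theta q) * (Complex.exp (Complex.I * k * theta q))⁻¹ := by
  rw [← Complex.exp_neg, ← Complex.exp_add]; congr 1; ring

theorem den_cast (q k : ℝ) : (den q k : ℂ) = 1 + q ^ 2 * (-2 + k ^ 2 + 2 * q ^ 2)
      + 2 * q * (k ^ 2 + q ^ 2) * mu k + (k ^ 2 + q ^ 2) * mu k ^ 2 := by
  simp [den]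

theorem hasDerivAt_tanh_shift (c x : ℝ) :
    HasDerivAt (fun y : ℝ => (Real.tanh (y + c) : ℂ)) (1 - (Real.tanh (x + c) : ℂ) ^ 2) x := by
  have h := Real.cosh_pos (x + c)
  have h1 : HasDerivAt Real.tanh (1 - Real.tanh (x + c) ^ 2) (x + c) := by
    have e : Real.tanh = fun y => Real.sinh y / Real.cosh y :=
      funext Real.tanh_eq_sinh_div_cosh
    rw [e]
    refine ((Real.hasDerivAt_sinh (x + c)).div (Real.hasDerivAt_cosh (x + c)) h.ne').congr_deriv ?_
    field_simp
  exact_mod_cast (h1.comp_add_const x c).ofReal_comp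

theorem hasDerivAt_exp_shift (z : ℂ) (c x : ℝ) :
    HasDerivAt (fun y : ℝ => Complex.exp (z * (y + c))) (z * Complex.exp (z * (x + c))) x := by
  have h : HasDerivAt (fun y : ℂ => Complex.exp (z * (y + c)))
      (z * Complex.exp (z * (x + c))) x := by
    refine (((hasDerivAt_id (x : ℂ)).add_const (c : ℂ)).const_mul z).cexp.congr_deriv ?_
    simp; ring
  exact h.comp_ofReal

theorem hasDerivAt_tanh_wave (z w : ℂ) (c : ℝ) :
    HasDerivAt (fun y : ℝ => Complex.exp (z * (y + c)) * ((Real.tanh (y + c) : ℂ) + w) ^ 2)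
      (Complex.exp (z * c) * (z * ((Real.tanh c : ℂ) + w) ^ 2
        + 2 * ((Real.tanh c : ℂ) + w) * (1 - (Real.tanh c : ℂ) ^ 2))) 0 := by
  refine ((hasDerivAt_exp_shift z c 0).mul
    (((hasDerivAt_tanh_shift c 0).add_const w).pow 2)).congr_deriv ?_
  simp; ring

theorem hasDerivAt_sech_wave (z : ℂ) (c : ℝ) :
    HasDerivAt (fun y : ℝ => Complex.exp (z * (y + c)) * -(sech (y + c) : ℂ) ^ 2)
      (Complex.exp (z * c) * (-z + 2 * (Real.tanh c : ℂ)) * (1 - (Real.tanh c : ℂ) ^ 2)) 0 := by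
  have e : (fun y : ℝ => Complex.exp (z * (y + c)) * -(sech (y + c) : ℂ) ^ 2) =
      fun y : ℝ => Complex.exp (z * (y + c)) * ((Real.tanh (y + c) : ℂ) ^ 2 - 1) := by
    funext y
    have h : (sech (y + c) : ℂ) ^ 2 = 1 - (Real.tanh (y + c) : ℂ) ^ 2 := by
      exact_mod_cast congrArg (fun z : ℝ => (z : ℂ)) (sech_sq (y + c))
    rw [h]; ring
  rw [e]
  refine ((hasDerivAt_exp_shift z c 0).mul
    (((hasDerivAt_tanh_shift c 0).pow 2).sub_const 1)).congr_deriv ?_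
  simp; ring

/-- The scattering coefficients are such that `ψ` is continuous at `0`. -/
theorem psi_continuity {q k : ℝ} (hq : |q| < 1) (hk : k ≠ 0) :
    psiLeft q 0 k = psiRight q 0 k := by
  have hd : (den q k : ℂ) ≠ 0 := by exact_mod_cast (den_pos hq k).ne'
  have hk' : (k : ℂ) ≠ 0 := by exact_mod_cast hk
  have hI := Complex.I_sq
  have hmu : (mu k : ℂ) ^ 2 = k ^ 2 + 2 := by exact_mod_cast mu_sq k
  have hs : (sech (theta q) : ℂ) ^ 2 = 1 - q ^ 2 := by
    have := sech_sq (theta q); rw [tanh_theta hq] at this; exact_mod_cast this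
  have hden := den_cast q k
  have e1 : Complex.exp (Complex.I * k * theta q) ≠ 0 := Complex.exp_ne_zero _
  have e2 : Complex.exp (mu k * theta q) ≠ 0 := Complex.exp_ne_zero _
  ext i
  fin_cases i <;>
  · simp only [psiLeft, psiRight, coefA, coefB, coefC, coefD, zero_sub, zero_add, sech_neg,
      Real.tanh_neg, tanh_theta hq, hs, mul_neg, Complex.ofReal_zero]
    rw [exp_aux1, exp_aux2]
    simp only [Complex.exp_neg]
    generalize Complex.exp (Complex.I * k * theta q) = E at *
    generalize Complex.exp (mu k * theta q) = F at *
    simp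
    field_simp
    rw [hden]
    clear hden hd e1 e2 hs hk' hk hq
    generalize (mu k : ℂ) = m at *
    generalize (k : ℂ) = k at *
    generalize (q : ℂ) = q at *
    grind

/-- The scattering coefficients are such that the derivative of `ψ` has at `0` the jump
`ψ'(0-) - ψ'(0+) = 2 q ψ(0)` that the potential `-2 q δ₀` of `H_q` prescribes. -/
theorem psi_jump {q k : ℝ} (hq : |q| < 1) (hk : k ≠ 0) (i : Fin 2) :
    ∃ l r : ℂ, HasDerivAt (fun x : ℝ => psiLeft q x k i) l 0 ∧
      HasDerivAt (fun x : ℝ => psiRight q x k i) r 0 ∧ l - r = 2 * q * psi q 0 k i := by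
  have hd : (den q k : ℂ) ≠ 0 := by exact_mod_cast (den_pos hq k).ne'
  have hk' : (k : ℂ) ≠ 0 := by exact_mod_cast hk
  have hI := Complex.I_sq
  have hmu : (mu k : ℂ) ^ 2 = k ^ 2 + 2 := by exact_mod_cast mu_sq k
  have hs : (sech (theta q) : ℂ) ^ 2 = 1 - q ^ 2 := by
    have := sech_sq (theta q); rw [tanh_theta hq] at this; exact_mod_cast this
  have hden := den_cast q k
  have e1 : Complex.exp (Complex.I * k * theta q) ≠ 0 := Complex.exp_ne_zero _
  have e2 : Complex.exp (mu k * theta q) ≠ 0 := Complex.exp_ne_zero _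
  fin_cases i
  · have L := (hasDerivAt_tanh_wave (Complex.I * k) (-(Complex.I * k)) (-theta q)).add
      ((hasDerivAt_sech_wave (mu k) (-theta q)).const_mul (coefA q k))
    have R := (((hasDerivAt_tanh_wave (Complex.I * k) (-(Complex.I * k)) (theta q)).const_mul
      (coefB q k)).add ((hasDerivAt_tanh_wave (-(Complex.I * k)) (Complex.I * k)
      (theta q)).const_mul (coefC q k))).add
      ((hasDerivAt_sech_wave (-mu k) (theta q)).const_mul (coefD q k))
    refine ⟨_, _, L.congr_of_eventuallyEq (.of_forall fun x => ?_),
      R.congr_of_eventuallyEq (.of_forall fun x => ?_), ?_⟩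
    · simp [psiLeft, sub_eq_add_neg]; ring
    · simp [psiRight, sub_eq_add_neg]; ring
    simp only [psi, le_refl, if_true, psiLeft, coefA, coefB, coefC, coefD, zero_sub, sech_neg,
      Complex.ofReal_neg, Real.tanh_neg, tanh_theta hq, hs, mul_neg, neg_mul,
      Complex.ofReal_zero]
    rw [exp_aux1, exp_aux2]
    simp only [Complex.exp_neg]
    generalize Complex.exp (Complex.I * k * theta q) = E at *
    generalize Complex.exp (mu k * theta q) = F at *
    simp
    field_simp
    rw [hden]
    clear L R hden hd e1 e2 hs hk' hk hq
    generalize (mu k : ℂ) = m at *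
    generalize (k : ℂ) = k at *
    generalize (q : ℂ) = q at *
    grind
  · have L := (hasDerivAt_sech_wave (Complex.I * k) (-theta q)).add
      ((hasDerivAt_tanh_wave (mu k) (-mu k) (-theta q)).const_mul (coefA q k))
    have R := (((hasDerivAt_sech_wave (Complex.I * k) (theta q)).const_mul
      (coefB q k)).add ((hasDerivAt_sech_wave (-(Complex.I * k))
      (theta q)).const_mul (coefC q k))).add
      ((hasDerivAt_tanh_wave (-mu k) (mu k) (theta q)).const_mul (coefD q k))
    refine ⟨_, _, L.congr_of_eventuallyEq (.of_forall fun x => ?_),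
      R.congr_of_eventuallyEq (.of_forall fun x => ?_), ?_⟩
    · simp [psiLeft, sub_eq_add_neg]; ring
    · simp [psiRight, sub_eq_add_neg]; ring
    simp only [psi, le_refl, if_true, psiLeft, coefA, coefB, coefC, coefD, zero_sub, sech_neg,
      Complex.ofReal_neg, Real.tanh_neg, tanh_theta hq, hs, mul_neg, neg_mul,
      Complex.ofReal_zero]
    rw [exp_aux1, exp_aux2]
    simp only [Complex.exp_neg]
    generalize Complex.exp (Complex.I * k * theta q) = E at *
    generalize Complex.exp (mu k * theta q) = F at *
    simp
    field_simp
    rw [hden]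
    clear L R hden hd e1 e2 hs hk' hk hq
    generalize (mu k : ℂ) = m at *
    generalize (k : ℂ) = k at *
    generalize (q : ℂ) = q at *
    grind

/-- The distorted plane waves `v₊(x, k)`, `k ≠ 0`: `a₊(k) ψ(-x, -k)` for `k > 0` and
`a₋(k) ψ(x, k)` for `k < 0`, where `a_±(k) = 1 / ((1 ± i k)² B(∓k))`. -/
def vPlus (q x k : ℝ) : Fin 2 → ℂ :=
  if 0 < k then (1 / ((1 + Complex.I * k) ^ 2 * coefB q (-k))) • psi q (-x) (-k)
  else (1 / ((1 - Complex.I * k) ^ 2 * coefB q k)) • psi q x k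

/-- The first component `a(x, k)` of `v₊(x, k)`. -/
def a (q x k : ℝ) : ℂ := vPlus q x k 0

/-- The second component `b(x, k)` of `v₊(x, k)`. -/
def b (q x k : ℝ) : ℂ := vPlus q x k 1

/-- The even part of `a` in `x`. -/
def aEven (q x k : ℝ) : ℂ := (a q x k + a q (-x) k) / 2

/-- The even part of `b` in `x`. -/
def bEven (q x k : ℝ) : ℂ := (b q x k + b q (-x) k) / 2

/-- The integrand, as a function of `x`, of the distorted Fourier transform `f(k)` of `w₀`. -/
def transformIntegrand (q : ℝ) (w₀ : ℝ → ℝ) (k x : ℝ) : ℂ :=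
  (conj (aEven q x k) - conj (bEven q x k)) * w₀ x

/-- The distorted Fourier transform `f(k)` of the even function `w₀`. -/
def transform (q : ℝ) (w₀ : ℝ → ℝ) (k : ℝ) : ℂ :=
  2 / √(2 * Real.pi) * ∫ x in Ioi (0 : ℝ), transformIntegrand q w₀ k x

/-- The integrand, as a function of `k`, in the formula for `w(0, t)`. -/
def waveIntegrand (q : ℝ) (w₀ : ℝ → ℝ) (t k : ℝ) : ℂ :=
  (a q 0 k * Complex.exp (-(1 / 2 * Complex.I * t * (1 + k ^ 2)))
    + b q 0 k * Complex.exp (1 / 2 * Complex.I * t * (1 + k ^ 2))) * transform q w₀ k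

/-- The value `w(0, t)` at `x = 0` of the continuous spectrum part of the linearized
propagator applied to `w₀`. -/
def wZero (q : ℝ) (w₀ : ℝ → ℝ) (t : ℝ) : ℂ :=
  √(2 / Real.pi) * ∫ k in Ioi (0 : ℝ), waveIntegrand q w₀ t k

/-- The assumptions on the perturbation `w₀` for the parameter `q` and the constants `C k l`:
`w₀` is real and even, smooth on `(0, ∞)`, and `‖x^k ∂^l w₀‖ ≤ C k l |q|` in `L^∞(0, ∞)`. -/
structure Admissible (C : ℕ → ℕ → ℝ) (q : ℝ) (w₀ : ℝ → ℝ) : Prop where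
  even : ∀ x, w₀ (-x) = w₀ x
  smooth : ContDiffOn ℝ ∞ w₀ (Ioi 0)
  bound : ∀ k l : ℕ, ∀ x : ℝ, 0 < x → |x ^ k * iteratedDeriv l w₀ x| ≤ C k l * |q|

end DeltaNLS

end

/-! For `k > 0` the even parts of `a` and `b` are one complex factor times real trigonometric
profiles. Adding `ψ(-x,-k)` and `ψ(x,-k)` cancels the real exponentials, since `D = -A`, and `(1 +
C(-k)) / B(-k)` is unimodular, so the two remaining waves are conjugate up to a common phase. In the
product of `a(0,k)` or `b(0,k)` with `f(k)` only the squared modulus `1 / ((1+k²)²(k²+q²))` of the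
factor survives. This leaves two Fresnel integrals of a real transform `J_q(k)` of `w₀`: the `a`
part has weight `k²/(1+k²)²`, because `a(0,k)` carries a factor `k²+q²`, and the `b` part has weight
`(1-q²) k²/(k²+q²)/(1+k²)²`.

Two replacements cost `O(q)` relative to the size `Q = O(q)` of `w₀`, hence `O(q²)` uniformly in
`t`. The transform `J_q` may be replaced by `J_0`, uniformly in `k`
(`abs_kernelTransform_sub_freeTransform_le`): integration by parts trades the growth `k²` of the
kernel for derivatives of `w₀`. In the `b` weight, `(1-q²)k²/(k²+q²)` may be replaced by `1`, the
difference being controlled by a Lorentzian of width `|q|`.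

After this, `J_0` is a cosine transform minus a constant. The weights `1/(1+k²)²` and `k²/(1+k²)²`
are cosine transforms of exponentially decaying profiles, so Parseval against the Fresnel kernel
(`integral_fresnel_mul_cosTransform`) gives a leading term, equal to the Fresnel constant times the
value of the integrand at `k = 0`, and an error `O(t^(-3/2))` (`norm_fresnelCos_sub_le`). At `k = 0`
the first weight is `1`, the second is `0`, and `J_0(0) = ∫₀^∞ w₀`; so only the `b` part contributes
at order `t^(-1/2)`. -/

namespace DeltaNLS

open Complex (I)
open Filter Topology

/-! ### Even parts of the distorted plane waves -/

/-- The scalar factor by which the even parts of `a` and `b` differ from real functions. -/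
noncomputable def evenFactor (q k : ℝ) : ℂ :=
  -I * Complex.exp (-(I * k * theta q)) / ((1 + I * k) ^ 2 * (q - I * k))

/-- The real function proportional to the even part of `a`. -/
noncomputable def evenProfileA (q k x : ℝ) : ℝ :=
  (q * (Real.tanh (x + theta q) ^ 2 - k ^ 2) + 2 * k ^ 2 * Real.tanh (x + theta q))
      * Real.sin (k * x)
    + (k * (Real.tanh (x + theta q) ^ 2 - k ^ 2) - 2 * q * k * Real.tanh (x + theta q))
      * Real.cos (k * x)

/-- The real function proportional to the even part of `b`. -/
noncomputable def evenProfileB (q k x : ℝ) : ℝ :=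
  -(1 - Real.tanh (x + theta q) ^ 2) * (q * Real.sin (k * x) + k * Real.cos (k * x))

/-- The kernel `(evenProfileA - evenProfileB) / k` of the transform of even functions. -/
noncomputable def kernel (q k x : ℝ) : ℝ :=
  (q * (1 - k ^ 2) + 2 * k ^ 2 * Real.tanh (x + theta q)) * (Real.sin (k * x) / k)
    + (1 - k ^ 2 - 2 * q * Real.tanh (x + theta q)) * Real.cos (k * x)

/-- The real transform of an even function against `kernel`. -/
noncomputable def kernelTransform (q : ℝ) (w : ℝ → ℝ) (k : ℝ) : ℝ :=
  ∫ x in Ioi (0 : ℝ), kernel q k x * w x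

theorem coefD_eq_neg_coefA (q k : ℝ) : coefD q k = -coefA q k := by
  unfold coefD coefA; ring

theorem ofReal_add_I_mul_ne_zero {x y : ℝ} (h : x ≠ 0) : (x + I * y : ℂ) ≠ 0 := fun h0 => h (by
  simpa using congrArg Complex.re h0)

theorem mu_gt_one (k : ℝ) : 1 < mu k := by
  have := mu_sq k
  have := mu_pos k
  nlinarith [sq_nonneg k]

/-- A rational identity modulo `μ² = k² + 2` and `i² = -1`. It makes the ratio of the outgoing
amplitude `1 + C(-k)` to the incoming amplitude `B(-k)` of the even wave unimodular. -/
theorem one_add_coefC {q k : ℝ} (hq : |q| < 1) (hk : k ≠ 0) :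
    (1 + coefC q (-k)) * (k + I * q)
      = coefB q (-k) * Complex.exp (-(2 * I * k * theta q)) * (k - I * q) := by
  have hd : (den q (-k) : ℂ) ≠ 0 := by exact_mod_cast (den_pos hq (-k)).ne'
  have hk' : (k : ℂ) ≠ 0 := by exact_mod_cast hk
  have hI := Complex.I_sq
  have hmu : (mu (-k) : ℂ) ^ 2 = k ^ 2 + 2 := by
    exact_mod_cast (mu_sq (-k)).trans (by ring)
  have hden := den_cast q (-k)
  have e1 : Complex.exp (2 * I * k * theta q) ≠ 0 := Complex.exp_ne_zero _
  have e2 : Complex.exp (-(2 * I * ((-k : ℝ) : ℂ) * theta q)) = Complex.exp (2 * I * k * theta q) := by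
    congr 1; push_cast; ring
  unfold coefB coefC
  rw [e2]
  simp only [Complex.exp_neg]
  generalize Complex.exp (2 * I * k * theta q) = E at *
  push_cast at *
  field_simp
  rw [hden]
  clear hden hd e1 e2 hk' hk hq
  generalize (mu (-k) : ℂ) = m at *
  generalize (k : ℂ) = k at *
  generalize (q : ℂ) = q at *
  grind

/-- The last two factors of the numerator have real part `-k (q + μ)`, nonzero because `μ > 1 >
|q|`. -/
theorem coefB_neg_ne_zero {q k : ℝ} (hq : |q| < 1) (hk : k ≠ 0) : coefB q (-k) ≠ 0 := by
  have hd : (den q (-k) : ℂ) ≠ 0 := by exact_mod_cast (den_pos hq (-k)).ne'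
  have hk' : ((-k : ℝ) : ℂ) ≠ 0 := by exact_mod_cast neg_ne_zero.2 hk
  have hm := mu_gt_one (-k)
  have hqm : -k * (q + mu (-k)) ≠ 0 :=
    mul_ne_zero (neg_ne_zero.2 hk) (by have := (abs_lt.1 hq).1; linarith)
  unfold coefB
  refine div_ne_zero (mul_ne_zero (mul_ne_zero (mul_ne_zero (Complex.exp_ne_zero _) ?_) ?_) ?_)
    (mul_ne_zero hk' hd)
  · intro h; apply hk; simpa using congrArg Complex.re h
  · intro h; apply hqm; simpa using congrArg Complex.re h
  · intro h; apply hqm; simpa using congrArg Complex.re h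

theorem exp_I_mul (k x : ℝ) :
    Complex.exp (I * k * x) = Real.cos (k * x) + Real.sin (k * x) * I := by
  rw [show I * k * x = ((k * x : ℝ) : ℂ) * I by push_cast; ring, Complex.exp_mul_I]
  simp

/-- The terms with `A` and `D = -A` cancel. What remains is `(1 + C) e^{ik(x+θ)} (t - ik)²` plus `B
e^{-ik(x+θ)} (t + ik)²` in the first component, and the same amplitudes times `-s²` in the second.
By `one_add_coefC` these are conjugate after a common phase is extracted, hence the real profiles.
-/
theorem psi_add_psi_neg {q k x : ℝ} (hq : |q| < 1) (hk : 0 < k) (hx : 0 ≤ x) (i : Fin 2) :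
    psi q (-x) (-k) i + psi q x (-k) i
      = coefB q (-k) * (-2 * I * Complex.exp (-(I * k * theta q)) / (q - I * k))
        * (![evenProfileA q k x, evenProfileB q k x] i : ℝ) := by
  have h1 : psi q (-x) (-k) = psiLeft q (-x) (-k) := by simp [psi, hx]
  have h2 : psi q x (-k) = psiRight q x (-k) := by
    rcases hx.eq_or_lt with rfl | hx
    · simp [psi, psi_continuity hq (neg_ne_zero.2 hk.ne')]
    · simp [psi, hx.not_ge]
  have hC := one_add_coefC hq hk.ne'
  have hs : (sech (x + theta q) : ℂ) ^ 2 = 1 - (Real.tanh (x + theta q) : ℂ) ^ 2 := by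
    exact_mod_cast sech_sq (x + theta q)
  have hkq : (k + I * q : ℂ) ≠ 0 := ofReal_add_I_mul_ne_zero hk.ne'
  have hqk : (q - I * k : ℂ) ≠ 0 := by
    intro h; apply hkq; linear_combination I * h + k * Complex.I_sq
  have hI := Complex.I_sq
  have hC' : coefC q (-k) = coefB q (-k) * Complex.exp (-(2 * I * k * theta q))
      * (k - I * q) / (k + I * q) - 1 := by
    field_simp
    linear_combination hC
  have e0 : -x - theta q = -(x + theta q) := by ring
  have e1 : Complex.exp (-(2 * I * k * theta q)) = (Complex.exp (I * k * theta q))⁻¹ ^ 2 :=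
    exp_aux1 q k
  have ek := exp_I_mul k x
  have ek' : (Complex.exp (I * k * x))⁻¹ = Real.cos (k * x) - Real.sin (k * x) * I := by
    rw [← Complex.exp_neg, show -(I * k * x) = I * k * ((-x : ℝ) : ℂ) by push_cast; ring,
      exp_I_mul]
    simp [sub_eq_add_neg]
  have hE : Complex.exp (I * k * theta q) ≠ 0 := Complex.exp_ne_zero _
  have hE2 : Complex.exp (I * k * (x + theta q))
      = Complex.exp (I * k * x) * Complex.exp (I * k * theta q) := by
    rw [← Complex.exp_add]; ring_nf
  have m1 : Complex.exp (I * ((-k : ℝ) : ℂ) * (((-x : ℝ) : ℂ) - theta q))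
      = (Real.cos (k * x) + Real.sin (k * x) * I) * Complex.exp (I * k * theta q) := by
    rw [← ek, ← hE2]; congr 1; push_cast; ring
  have m2 : Complex.exp (I * ((-k : ℝ) : ℂ) * (x + theta q))
      = (Real.cos (k * x) - Real.sin (k * x) * I) * (Complex.exp (I * k * theta q))⁻¹ := by
    rw [← ek', ← mul_inv, ← hE2, ← Complex.exp_neg]; congr 1; push_cast; ring
  have m3 : Complex.exp (-(I * ((-k : ℝ) : ℂ) * (x + theta q)))
      = (Real.cos (k * x) + Real.sin (k * x) * I) * Complex.exp (I * k * theta q) := by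
    rw [← ek, ← hE2]; congr 1; push_cast; ring
  have m4 : Complex.exp (mu (-k) * (((-x : ℝ) : ℂ) - theta q))
      = Complex.exp (-(mu (-k) * (x + theta q))) := by
    congr 1; push_cast; ring
  have m5 : Complex.exp (-(I * k * theta q)) = (Complex.exp (I * k * theta q))⁻¹ :=
    Complex.exp_neg _
  have cs : (Real.cos (k * x) : ℂ) ^ 2 + (Real.sin (k * x) : ℂ) ^ 2 = 1 := by
    exact_mod_cast Real.cos_sq_add_sin_sq (k * x)
  have hkq' : (q - I * k : ℂ) = -I * (k + I * q) := by linear_combination q * hI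
  rw [h1, h2]
  simp only [psiLeft, psiRight, coefD_eq_neg_coefA, e0, Real.tanh_neg, sech_neg, m1, m2, m3, m4, m5,
    hC', hs, e1, hkq']
  clear h1 h2 hC hC' m1 m2 m3 m4 m5 e0 e1 ek ek' hE2 hs hqk hkq'
  fin_cases i
  all_goals
    simp [evenProfileA, evenProfileB]
    generalize (Complex.cos (k * x)) = c at *
    generalize (Complex.sin (k * x)) = s at *
    generalize Complex.exp (I * k * theta q) = E at *
    generalize Complex.exp (-(mu (-k) * (x + theta q))) = M at *
    generalize coefB q (-k) = B at *
    generalize coefA q (-k) = A at *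
    generalize (Complex.tanh (x + theta q)) = T at *
    generalize (mu (-k) : ℂ) = m at *
    generalize (k : ℂ) = k at *
    generalize (q : ℂ) = q at *
    field_simp
    grind

theorem vPlus_even {q k x : ℝ} (hq : |q| < 1) (hk : 0 < k) (hx : 0 ≤ x) (i : Fin 2) :
    (vPlus q x k i + vPlus q (-x) k i) / 2
      = evenFactor q k * (![evenProfileA q k x, evenProfileB q k x] i : ℝ) := by
  have h := psi_add_psi_neg hq hk hx i
  have hB := coefB_neg_ne_zero hq hk.ne'
  have h1 : (1 + I * k : ℂ) ≠ 0 := by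
    simpa using ofReal_add_I_mul_ne_zero (x := 1) (y := k) one_ne_zero
  have e : (vPlus q x k i + vPlus q (-x) k i) / 2
      = (psi q (-x) (-k) i + psi q x (-k) i) / (2 * ((1 + I * k) ^ 2 * coefB q (-k))) := by
    simp [vPlus, hk]
    field_simp
  rw [e, h, evenFactor]
  field_simp

theorem aEven_eq {q k x : ℝ} (hq : |q| < 1) (hk : 0 < k) (hx : 0 ≤ x) :
    aEven q x k = evenFactor q k * evenProfileA q k x := by
  simpa [aEven, a] using vPlus_even hq hk hx 0

theorem bEven_eq {q k x : ℝ} (hq : |q| < 1) (hk : 0 < k) (hx : 0 ≤ x) :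
    bEven q x k = evenFactor q k * evenProfileB q k x := by
  simpa [bEven, b] using vPlus_even hq hk hx 1

theorem a_zero_eq {q k : ℝ} (hq : |q| < 1) (hk : 0 < k) :
    a q 0 k = evenFactor q k * (-k * (k ^ 2 + q ^ 2) : ℝ) := by
  have h := aEven_eq hq hk le_rfl
  have e : aEven q 0 k = a q 0 k := by simp [aEven]
  rw [← e, h]
  congr 2
  simp [evenProfileA, tanh_theta hq]
  ring

theorem b_zero_eq {q k : ℝ} (hq : |q| < 1) (hk : 0 < k) :
    b q 0 k = evenFactor q k * (-(1 - q ^ 2) * k : ℝ) := by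
  have h := bEven_eq hq hk le_rfl
  have e : bEven q 0 k = b q 0 k := by simp [bEven]
  rw [← e, h]
  congr 2
  simp [evenProfileB, tanh_theta hq]

theorem evenProfile_sub (q : ℝ) {k : ℝ} (hk : k ≠ 0) (x : ℝ) :
    evenProfileA q k x - evenProfileB q k x = k * kernel q k x := by
  unfold evenProfileA evenProfileB kernel
  field_simp
  ring

theorem transformIntegrand_eq {q k x : ℝ} (w : ℝ → ℝ) (hq : |q| < 1) (hk : 0 < k) (hx : 0 ≤ x) :
    transformIntegrand q w k x = conj (evenFactor q k) * k * (kernel q k x * w x : ℝ) := by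
  rw [transformIntegrand, aEven_eq hq hk hx, bEven_eq hq hk hx]
  have h : (evenProfileA q k x : ℂ) - evenProfileB q k x = k * kernel q k x := by
    exact_mod_cast evenProfile_sub q hk.ne' x
  simp only [map_mul, Complex.conj_ofReal, Complex.ofReal_mul]
  linear_combination conj (evenFactor q k) * w x * h

theorem transform_eq {q k : ℝ} (w : ℝ → ℝ) (hq : |q| < 1) (hk : 0 < k) :
    transform q w k
      = 2 / √(2 * Real.pi) * (conj (evenFactor q k) * k * kernelTransform q w k) := by
  rw [transform, kernelTransform, ← integral_complex_ofReal,
    ← integral_const_mul (conj (evenFactor q k) * k)]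
  congr 1
  exact setIntegral_congr_fun measurableSet_Ioi fun x hx =>
    transformIntegrand_eq w hq hk (mem_Ioi.1 hx).le

theorem evenFactor_mul_conj {q k : ℝ} :
    evenFactor q k * conj (evenFactor q k) = (1 / ((1 + k ^ 2) ^ 2 * (k ^ 2 + q ^ 2)) : ℝ) := by
  rw [Complex.mul_conj, Complex.normSq_eq_norm_sq]
  congr 1
  have h1 : ‖Complex.exp (-(I * k * theta q))‖ = 1 := by
    rw [Complex.norm_exp]; simp
  have h2 : ‖(1 + I * k : ℂ)‖ ^ 2 = 1 + k ^ 2 := by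
    rw [← Complex.normSq_eq_norm_sq, Complex.normSq_apply]; simp; ring
  have h3 : ‖(q - I * k : ℂ)‖ ^ 2 = k ^ 2 + q ^ 2 := by
    rw [← Complex.normSq_eq_norm_sq, Complex.normSq_apply]; simp; ring
  rw [evenFactor, norm_div, norm_mul, norm_mul, norm_neg, Complex.norm_I, h1, norm_pow, h2,
    div_pow, mul_pow _ ‖(q - I * k : ℂ)‖, h3]
  simp

/-- The factor `k² + q²` of `a(0,k)` cancels the denominator of the squared modulus of `evenFactor`.
For `b(0,k)` nothing cancels, and the weight `k²/(k²+q²)`, singular as `q → 0`, appears only there.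
-/
theorem waveIntegrand_eq {q k : ℝ} (w : ℝ → ℝ) (t : ℝ) (hq : |q| < 1) (hk : 0 < k) :
    waveIntegrand q w t k = -(2 / √(2 * Real.pi)) *
      (Complex.exp (-(I * t / 2)) * (Complex.exp (I * ((-t : ℝ) : ℂ) * k ^ 2 / 2)
          * (k ^ 2 / (1 + k ^ 2) ^ 2 * kernelTransform q w k : ℝ))
        + Complex.exp (I * t / 2) * (Complex.exp (I * t * k ^ 2 / 2)
          * ((1 - q ^ 2) * k ^ 2 / (k ^ 2 + q ^ 2) * (kernelTransform q w k / (1 + k ^ 2) ^ 2)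
            : ℝ))) := by
  have h := @evenFactor_mul_conj q k
  have hp : (0 : ℝ) < k ^ 2 + q ^ 2 := by positivity
  have hp' : (k ^ 2 + q ^ 2 : ℂ) ≠ 0 := by exact_mod_cast hp.ne'
  have hr : (1 + k ^ 2 : ℂ) ≠ 0 := by exact_mod_cast (by positivity : (1 + k ^ 2 : ℝ) ≠ 0)
  have e1 : Complex.exp (-(1 / 2 * I * t * (1 + k ^ 2)))
      = Complex.exp (-(I * t / 2)) * Complex.exp (I * ((-t : ℝ) : ℂ) * k ^ 2 / 2) := by
    rw [← Complex.exp_add]; congr 1; push_cast; ring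
  have e2 : Complex.exp (1 / 2 * I * t * (1 + k ^ 2))
      = Complex.exp (I * t / 2) * Complex.exp (I * t * k ^ 2 / 2) := by
    rw [← Complex.exp_add]; congr 1; ring
  rw [waveIntegrand, a_zero_eq hq hk, b_zero_eq hq hk, transform_eq w hq hk, e1, e2]
  generalize Complex.exp (-(I * t / 2)) = E1
  generalize Complex.exp (I * t / 2) = E2
  generalize Complex.exp (I * ((-t : ℝ) : ℂ) * k ^ 2 / 2) = E3
  generalize Complex.exp (I * t * k ^ 2 / 2) = E4
  generalize kernelTransform q w k = J
  generalize (2 / √(2 * Real.pi) : ℂ) = c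
  have e : (evenFactor q k * ((-k * (k ^ 2 + q ^ 2) : ℝ) : ℂ) * (E1 * E3)
      + evenFactor q k * ((-(1 - q ^ 2) * k : ℝ) : ℂ) * (E2 * E4))
        * (c * (conj (evenFactor q k) * k * J))
      = (evenFactor q k * conj (evenFactor q k)) * (((-k * (k ^ 2 + q ^ 2) : ℝ) : ℂ) * (E1 * E3)
      + ((-(1 - q ^ 2) * k : ℝ) : ℂ) * (E2 * E4)) * (c * (k * J)) := by ring
  rw [e, h]
  push_cast
  field_simp
  ring


/-! ### Cosine transforms against Gaussian and Fresnel kernels -/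

theorem norm_cexp_neg_mul_sq_le_one {b : ℂ} (hb : 0 ≤ b.re) (x : ℝ) :
    ‖Complex.exp (-b * x ^ 2)‖ ≤ 1 := by
  rw [norm_cexp_neg_mul_sq, Real.exp_le_one_iff]
  nlinarith [mul_nonneg hb (sq_nonneg x)]

theorem norm_cexp_neg_sq_div_le_one {b : ℂ} (hb : 0 ≤ b.re) (x : ℝ) :
    ‖Complex.exp (-x ^ 2 / (4 * b))‖ ≤ 1 := by
  have h : (-x ^ 2 / (4 * b) : ℂ) = -(4 * b)⁻¹ * x ^ 2 := by rw [div_eq_mul_inv]; ring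
  rw [h]
  apply norm_cexp_neg_mul_sq_le_one
  rw [Complex.inv_re]
  have : (4 * b).re = 4 * b.re := by simp
  rw [this]
  exact div_nonneg (by positivity) (Complex.normSq_nonneg _)

theorem integral_Ioi_gaussian_mul_cos {b : ℂ} (hb : 0 < b.re) (z : ℝ) :
    ∫ k in Ioi (0 : ℝ), Complex.exp (-b * k ^ 2) * Real.cos (k * z)
      = (Real.pi / b) ^ (1 / 2 : ℂ) / 2 * Complex.exp (-z ^ 2 / (4 * b)) := by
  set f : ℝ → ℂ := fun k => Complex.exp (I * z * k) * Complex.exp (-b * k ^ 2) with hf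
  have hfi : Integrable f := by
    refine (integrable_cexp_neg_mul_sq hb).bdd_mul (c := 1) (by fun_prop) (.of_forall fun k => ?_)
    rw [Complex.norm_exp]; simp
  have h := fourierIntegral_gaussian hb (z : ℂ)
  have hneg : ∫ k in Iic (0 : ℝ), f k = ∫ k in Ioi (0 : ℝ), f (-k) := by
    simp [integral_comp_neg_Ioi 0 f]
  have hfn : Integrable fun k => f (-k) := hfi.comp_neg
  rw [← intervalIntegral.integral_Iic_add_Ioi hfi.integrableOn hfi.integrableOn, hneg,
    ← integral_add hfn.integrableOn hfi.integrableOn] at h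
  have e : ∀ k : ℝ, f (-k) + f k = 2 * (Complex.exp (-b * k ^ 2) * Real.cos (k * z)) := by
    intro k
    have e1 : Complex.exp (I * z * k) = Complex.exp (((k * z : ℝ) : ℂ) * I) := by
      congr 1; push_cast; ring
    have e2 : Complex.exp (I * z * (-k : ℝ)) = Complex.exp (-((k * z : ℝ) : ℂ) * I) := by
      congr 1; push_cast; ring
    simp only [hf]
    rw [e1, e2, Complex.ofReal_cos, Complex.cos]
    push_cast
    ring_nf
  simp only [e] at h
  rw [integral_const_mul] at h
  linear_combination h / 2

/-- Fubini and the Gaussian integral. The phase is `k z(y)` rather than `k y` so that `z(y) = x + y`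
covers a multiplier times `cos (k x)`. -/
theorem integral_gaussian_mul_cosTransform {b : ℂ} (hb : 0 < b.re) {P z G : ℝ → ℝ}
    (hP : Integrable P) (hz : Continuous z)
    (hG : ∀ k, G k = ∫ y, P y * Real.cos (k * z y)) :
    ∫ k in Ioi (0 : ℝ), Complex.exp (-b * k ^ 2) * G k
      = (Real.pi / b) ^ (1 / 2 : ℂ) / 2 * ∫ y, P y * Complex.exp (-z y ^ 2 / (4 * b)) := by
  have hint : Integrable (fun p : ℝ × ℝ => Complex.exp (-b * p.1 ^ 2) * (P p.2 : ℂ)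
      * Real.cos (p.1 * z p.2)) ((volume.restrict (Ioi 0)).prod volume) := by
    refine (((integrable_cexp_neg_mul_sq hb).integrableOn).mul_prod hP.ofReal).mul_bdd (c := 1)
      (by fun_prop) (.of_forall fun p => ?_)
    rw [Complex.norm_real]
    exact Real.abs_cos_le_one _
  calc ∫ k in Ioi (0 : ℝ), Complex.exp (-b * k ^ 2) * G k
      = ∫ k in Ioi (0 : ℝ), ∫ y, Complex.exp (-b * k ^ 2) * (P y : ℂ) * Real.cos (k * z y) := by
        congr 1; ext k
        rw [hG, ← integral_complex_ofReal, ← integral_const_mul]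
        congr 1; ext y
        push_cast; ring
    _ = ∫ y, ∫ k in Ioi (0 : ℝ), Complex.exp (-b * k ^ 2) * (P y : ℂ) * Real.cos (k * z y) :=
        integral_integral_swap hint
    _ = ∫ y, (Real.pi / b) ^ (1 / 2 : ℂ) / 2 * (P y * Complex.exp (-z y ^ 2 / (4 * b))) := by
        congr 1; ext y
        have := integral_Ioi_gaussian_mul_cos hb (z y)
        rw [mul_left_comm, ← this, ← integral_const_mul]
        congr 1; ext k
        ring
    _ = _ := integral_const_mul _ _

/-- Parseval's identity for a cosine transform against the Fresnel kernel. -/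
theorem integral_fresnel_mul_cosTransform {τ : ℝ} (hτ : τ ≠ 0) {P z G : ℝ → ℝ}
    (hP : Integrable P) (hz : Continuous z)
    (hG : ∀ k, G k = ∫ y, P y * Real.cos (k * z y)) (hGi : IntegrableOn G (Ioi 0)) :
    ∫ k in Ioi (0 : ℝ), Complex.exp (I * τ * k ^ 2 / 2) * G k
      = (Real.pi / (-(I * τ / 2))) ^ (1 / 2 : ℂ) / 2
        * ∫ y, P y * Complex.exp (-z y ^ 2 / (4 * (-(I * τ / 2)))) := by
  -- Regularization: the Gaussian identity holds for `Re b = ε > 0`, and both sides converge as `ε →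
  -- 0+`, dominated by `‖G‖` and `‖P‖`. The square root is continuous at the limit because `π / b 0`
  -- is purely imaginary and so off the branch cut.
  set b : ℝ → ℂ := fun ε => ε + -(I * τ / 2) with hb
  have hbre : ∀ ε : ℝ, (b ε).re = ε := fun ε => by simp [hb]
  have hb0 : b 0 = -(I * τ / 2) := by simp [hb]
  have hbne : b 0 ≠ 0 := by
    rw [hb0]; simpa using hτ
  have hbc : Continuous b := by fun_prop
  have hbt : Tendsto b (𝓝[>] 0) (𝓝 (b 0)) := hbc.continuousAt.tendsto.mono_left nhdsWithin_le_nhds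
  have hl : Tendsto (fun ε => ∫ k in Ioi (0 : ℝ), Complex.exp (-b ε * k ^ 2) * G k) (𝓝[>] 0)
      (𝓝 (∫ k in Ioi (0 : ℝ), Complex.exp (-b 0 * k ^ 2) * G k)) := by
    refine tendsto_integral_filter_of_dominated_convergence (fun k => ‖G k‖) ?_ ?_ hGi.norm ?_
    · exact .of_forall fun ε => (by fun_prop : Continuous fun k : ℝ =>
        Complex.exp (-b ε * k ^ 2)).aestronglyMeasurable.mul hGi.ofReal.aestronglyMeasurable
    · filter_upwards [self_mem_nhdsWithin] with ε hε
      refine .of_forall fun k => ?_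
      rw [norm_mul, Complex.norm_real]
      exact mul_le_of_le_one_left (norm_nonneg _)
        (norm_cexp_neg_mul_sq_le_one (by rw [hbre]; exact (mem_Ioi.1 hε).le) k)
    · refine .of_forall fun k => ?_
      exact ((Complex.continuous_exp.tendsto _).comp (hbt.neg.mul_const _)).mul_const _
  have hr : Tendsto (fun ε => (Real.pi / b ε) ^ (1 / 2 : ℂ) / 2
        * ∫ y, P y * Complex.exp (-z y ^ 2 / (4 * b ε))) (𝓝[>] 0)
      (𝓝 ((Real.pi / b 0) ^ (1 / 2 : ℂ) / 2
        * ∫ y, P y * Complex.exp (-z y ^ 2 / (4 * b 0)))) := by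
    refine Tendsto.mul (Tendsto.div_const ?_ _) ?_
    · refine (tendsto_const_nhds.div hbt hbne).cpow tendsto_const_nhds (Or.inr ?_)
      rw [hb0, Complex.div_im]
      simp [Complex.normSq_apply, Real.pi_ne_zero, hτ]
    · refine tendsto_integral_filter_of_dominated_convergence (fun y => ‖P y‖) ?_ ?_ hP.norm ?_
      · exact .of_forall fun ε => hP.ofReal.aestronglyMeasurable.mul (by
          fun_prop : Continuous fun y : ℝ =>
            Complex.exp (-z y ^ 2 / (4 * b ε))).aestronglyMeasurable
      · filter_upwards [self_mem_nhdsWithin] with ε hε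
        refine .of_forall fun y => ?_
        rw [norm_mul, Complex.norm_real]
        exact mul_le_of_le_one_right (norm_nonneg _)
          (norm_cexp_neg_sq_div_le_one (by rw [hbre]; exact (mem_Ioi.1 hε).le) (z y))
      · refine .of_forall fun y => ?_
        exact ((Complex.continuous_exp.tendsto _).comp (tendsto_const_nhds.div (hbt.const_mul 4)
          (by simpa using hbne))).const_mul _
  have he : (fun ε => ∫ k in Ioi (0 : ℝ), Complex.exp (-b ε * k ^ 2) * G k) =ᶠ[𝓝[>] 0]
      fun ε => (Real.pi / b ε) ^ (1 / 2 : ℂ) / 2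
        * ∫ y, P y * Complex.exp (-z y ^ 2 / (4 * b ε)) := by
    filter_upwards [self_mem_nhdsWithin] with ε hε
    exact integral_gaussian_mul_cosTransform (by rw [hbre]; exact hε) hP hz hG
  have := tendsto_nhds_unique (hl.congr' he) hr
  rw [hb0] at this
  rw [← this]
  congr 1; ext k
  congr 2; ring

theorem fresnel_const {t : ℝ} (ht : 0 < t) :
    ((Real.pi : ℂ) / (-(I * t / 2))) ^ (1 / 2 : ℂ)
      = √(2 * Real.pi / t) * Complex.exp (I * Real.pi / 4) := by
  have hp : (0 : ℝ) < 2 * Real.pi / t := by positivity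
  have e : (Real.pi : ℂ) / (-(I * t / 2)) = ((2 * Real.pi / t : ℝ) : ℂ) * I := by
    have : (t : ℂ) ≠ 0 := by exact_mod_cast ht.ne'
    push_cast
    field_simp
    linear_combination -Complex.I_sq
  rw [e, Complex.cpow_def_of_ne_zero (mul_ne_zero (by exact_mod_cast hp.ne') Complex.I_ne_zero),
    Complex.log_ofReal_mul hp Complex.I_ne_zero, Complex.log_I, add_mul, Complex.exp_add]
  congr 1
  · rw [Real.sqrt_eq_rpow, Real.rpow_def_of_pos hp]; push_cast; rfl
  · congr 1; ring

theorem norm_fresnel_const {τ : ℝ} (hτ : τ ≠ 0) :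
    ‖((Real.pi : ℂ) / (-(I * τ / 2))) ^ (1 / 2 : ℂ)‖ = √(2 * Real.pi / |τ|) := by
  rw [show (1 / 2 : ℂ) = ((1 / 2 : ℝ) : ℂ) by push_cast; rfl, Complex.norm_cpow_real, Real.sqrt_eq_rpow]
  congr 1
  simp [abs_of_pos Real.pi_pos]
  field_simp


/-! ### The two multipliers and their Fresnel asymptotics -/

/-- The function whose cosine transform is `cosMultiplier`. -/
noncomputable def expProfile (σ y : ℝ) : ℝ := (1 + σ * |y|) * Real.exp (-|y|) / 4

/-- The multiplier `1 / (1 + k²)²` for `σ = 1`, and `k² / (1 + k²)²` for `σ = -1`. -/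
noncomputable def cosMultiplier (σ k : ℝ) : ℝ :=
  (1 / (1 + k ^ 2) + σ * ((1 - k ^ 2) / (1 + k ^ 2) ^ 2)) / 2

theorem continuous_expProfile (σ : ℝ) : Continuous (expProfile σ) := by
  unfold expProfile; fun_prop

theorem continuous_cosMultiplier (σ : ℝ) : Continuous (cosMultiplier σ) := by
  unfold cosMultiplier
  have : ∀ k : ℝ, 1 + k ^ 2 ≠ 0 := fun k => by positivity
  fun_prop (disch := intro k; simp [this])

theorem cosMultiplier_one (k : ℝ) : cosMultiplier 1 k = 1 / (1 + k ^ 2) ^ 2 := by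
  unfold cosMultiplier; field_simp; ring

theorem cosMultiplier_neg_one (k : ℝ) : cosMultiplier (-1) k = k ^ 2 / (1 + k ^ 2) ^ 2 := by
  unfold cosMultiplier; field_simp; ring

/-- From `(1 + y/5)^5 ≤ e^y`; the fifth power matches `(1 + y)(1 + y²)² ≤ (1 + y)^5`, and `3125 =
5^5`. -/
theorem one_add_mul_exp_neg_le {y : ℝ} (hy : 0 ≤ y) :
    (1 + y) * Real.exp (-y) ≤ 3125 / (1 + y ^ 2) ^ 2 := by
  have h1 : 1 + y / 5 ≤ Real.exp (y / 5) := by linarith [Real.add_one_le_exp (y / 5)]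
  have h2 : (1 + y / 5) ^ 5 ≤ Real.exp y := by
    calc (1 + y / 5) ^ 5 ≤ Real.exp (y / 5) ^ 5 := by gcongr
      _ = Real.exp y := by rw [← Real.exp_nat_mul]; congr 1; push_cast; ring
  have h3 : (1 + y) ^ 5 ≤ 3125 * Real.exp y := by
    calc (1 + y) ^ 5 ≤ (5 * (1 + y / 5)) ^ 5 := by gcongr; linarith
      _ = 3125 * (1 + y / 5) ^ 5 := by ring
      _ ≤ _ := by gcongr
  have h4 : (1 + y) * (1 + y ^ 2) ^ 2 ≤ (1 + y) ^ 5 := by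
    calc (1 + y) * (1 + y ^ 2) ^ 2 ≤ (1 + y) * ((1 + y) ^ 2) ^ 2 := by gcongr; nlinarith
      _ = _ := by ring
  rw [Real.exp_neg, ← div_eq_mul_inv, div_le_div_iff₀ (Real.exp_pos y) (by positivity)]
  exact h4.trans h3

theorem abs_expProfile_le {σ : ℝ} (hσ : |σ| ≤ 1) (y : ℝ) :
    |expProfile σ y| ≤ 782 / (1 + y ^ 2) ^ 2 := by
  have h := one_add_mul_exp_neg_le (abs_nonneg y)
  rw [sq_abs] at h
  have h1 : |1 + σ * (|y|)| ≤ 1 + |y| := by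
    refine (abs_add_le _ _).trans ?_
    rw [abs_one, abs_mul, abs_abs]
    gcongr
    exact mul_le_of_le_one_left (abs_nonneg y) hσ
  have h2 : |expProfile σ y| ≤ (1 + |y|) * Real.exp (-|y|) / 4 := by
    rw [expProfile, abs_div, abs_mul, abs_of_pos (Real.exp_pos _), abs_of_pos (four_pos : (0 : ℝ) < 4)]
    gcongr
  refine h2.trans ?_
  calc (1 + |y|) * Real.exp (-|y|) / 4 ≤ 3125 / (1 + y ^ 2) ^ 2 / 4 := by gcongr
    _ = (3125 / 4) / (1 + y ^ 2) ^ 2 := by ring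
    _ ≤ _ := by gcongr; norm_num

theorem one_div_sq_le_inv (y : ℝ) : 1 / (1 + y ^ 2) ^ 2 ≤ (1 + y ^ 2)⁻¹ := by
  rw [one_div]
  gcongr
  nlinarith [sq_nonneg y]

theorem integrable_of_decay {f : ℝ → ℝ} {D : ℝ} (hf : Continuous f)
    (hd : ∀ y, |f y| ≤ D * (1 + y ^ 2)⁻¹) : Integrable f :=
  (integrable_inv_one_add_sq.const_mul D).mono' hf.aestronglyMeasurable (.of_forall hd)

theorem expProfile_mul_sq_le {σ : ℝ} (hσ : |σ| ≤ 1) (x y : ℝ) :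
    |expProfile σ y * (x + y) ^ 2| ≤ 1564 * (1 + x ^ 2) * (1 + y ^ 2)⁻¹ := by
  rw [abs_mul, abs_of_nonneg (sq_nonneg (x + y))]
  calc |expProfile σ y| * (x + y) ^ 2
      ≤ 782 / (1 + y ^ 2) ^ 2 * (2 * ((1 + x ^ 2) * (1 + y ^ 2))) := by
        gcongr
        · exact abs_expProfile_le hσ y
        · nlinarith [sq_nonneg (x - y), mul_nonneg (sq_nonneg x) (sq_nonneg y)]
    _ = _ := by field_simp; norm_num

theorem integrable_expProfile {σ : ℝ} (hσ : |σ| ≤ 1) : Integrable (expProfile σ) := by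
  refine integrable_of_decay (D := 782) (continuous_expProfile σ) fun y =>
    (abs_expProfile_le hσ y).trans ?_
  rw [div_eq_mul_one_div]
  gcongr
  exact one_div_sq_le_inv y

theorem integral_Ioi_expProfile_mul_cos {σ : ℝ} (hσ : |σ| ≤ 1) (k : ℝ) :
    ∫ y in Ioi (0 : ℝ), expProfile σ y * Real.cos (k * y) = cosMultiplier σ k / 2 := by
  have hk : 1 + k ^ 2 ≠ 0 := by positivity
  -- An explicit antiderivative of the integrand on the half line; it vanishes at infinity, and `F 0
  -- = -cosMultiplier σ k / 2`.
  set F : ℝ → ℝ := fun y => (Real.exp (-y) * ((k * Real.sin (k * y) - Real.cos (k * y)) / (1 + k ^ 2))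
      + σ * (y * Real.exp (-y) * ((k * Real.sin (k * y) - Real.cos (k * y)) / (1 + k ^ 2))
        + Real.exp (-y) * ((2 * k * Real.sin (k * y) - (1 - k ^ 2) * Real.cos (k * y))
          / (1 + k ^ 2) ^ 2))) / 4 with hF
  have hs : ∀ y, HasDerivAt (fun y => Real.sin (k * y)) (k * Real.cos (k * y)) y := fun y => by
    simpa [mul_comm] using ((hasDerivAt_id y).const_mul k).sin
  have hc : ∀ y, HasDerivAt (fun y => Real.cos (k * y)) (-(k * Real.sin (k * y))) y := fun y => by
    simpa [mul_comm] using ((hasDerivAt_id y).const_mul k).cos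
  have he : ∀ y, HasDerivAt (fun y => Real.exp (-y)) (-Real.exp (-y)) y := fun y => by
    simpa using (hasDerivAt_neg y).exp
  have hd : ∀ y, HasDerivAt F ((1 + σ * y) * Real.exp (-y) / 4 * Real.cos (k * y)) y := by
    intro y
    have h1 := (((hs y).const_mul k).sub (hc y)).div_const (1 + k ^ 2)
    have h2 := (((hs y).const_mul (2 * k)).sub ((hc y).const_mul (1 - k ^ 2))).div_const
      ((1 + k ^ 2) ^ 2)
    refine ((((he y).mul h1).add (((((hasDerivAt_id y).mul (he y)).mul h1).add
      ((he y).mul h2)).const_mul σ)).div_const 4).congr_deriv ?_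
    simp only [id, Pi.sub_apply, Pi.mul_apply]
    field_simp
    ring
  have hb : ∀ (g : ℝ → ℝ) (c d : ℝ), Tendsto g atTop (𝓝 0) →
      Tendsto (fun y => g y * (c * Real.sin (k * y) + d * Real.cos (k * y))) atTop (𝓝 0) := by
    intro g c d hg
    refine hg.zero_mul_isBoundedUnder_le (isBoundedUnder_of ⟨|c| + |d|, fun y => ?_⟩)
    simp only [Function.comp, Real.norm_eq_abs]
    refine (abs_add_le _ _).trans ?_
    rw [abs_mul, abs_mul]
    exact add_le_add (mul_le_of_le_one_right (abs_nonneg c) (Real.abs_sin_le_one _))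
      (mul_le_of_le_one_right (abs_nonneg d) (Real.abs_cos_le_one _))
  have t0 : Tendsto (fun y : ℝ => Real.exp (-y)) atTop (𝓝 0) := Real.tendsto_exp_neg_atTop_nhds_zero
  have t1 : Tendsto (fun y : ℝ => y * Real.exp (-y)) atTop (𝓝 0) := by
    simpa using Real.tendsto_pow_mul_exp_neg_atTop_nhds_zero 1
  have ht : Tendsto F atTop (𝓝 0) := by
    have h := (((hb _ (k / (1 + k ^ 2)) (-1 / (1 + k ^ 2)) t0).add
      (((hb _ (k / (1 + k ^ 2)) (-1 / (1 + k ^ 2)) t1).add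
      (hb _ (2 * k / (1 + k ^ 2) ^ 2) (-(1 - k ^ 2) / (1 + k ^ 2) ^ 2) t0)).const_mul σ))).div_const 4
    refine (h.congr fun y => ?_).trans (by simp)
    simp only [hF]
    ring
  have hE : EqOn (fun y => expProfile σ y * Real.cos (k * y))
      (fun y => (1 + σ * y) * Real.exp (-y) / 4 * Real.cos (k * y)) (Ioi 0) := by
    intro y hy
    simp [expProfile, abs_of_pos (mem_Ioi.1 hy)]
  have hi : IntegrableOn (fun y => expProfile σ y * Real.cos (k * y)) (Ioi 0) :=
    ((integrable_expProfile hσ).mul_bdd (c := 1) (by fun_prop)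
      (.of_forall fun y => Real.abs_cos_le_one _)).integrableOn
  rw [setIntegral_congr_fun measurableSet_Ioi hE,
    integral_Ioi_of_hasDerivAt_of_tendsto' (fun y _ => hd y)
      (hi.congr_fun hE measurableSet_Ioi) ht]
  simp [hF, cosMultiplier]
  field_simp
  ring

theorem integral_expProfile_mul_cos {σ : ℝ} (hσ : |σ| ≤ 1) (k x : ℝ) :
    ∫ y, expProfile σ y * Real.cos (k * (x + y)) = cosMultiplier σ k * Real.cos (k * x) := by
  have hi := integrable_expProfile hσ
  have hc : Integrable fun y => expProfile σ y * Real.cos (k * y) :=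
    hi.mul_bdd (c := 1) (by fun_prop) (.of_forall fun y => Real.abs_cos_le_one _)
  have hs : Integrable fun y => expProfile σ y * Real.sin (k * y) :=
    hi.mul_bdd (c := 1) (by fun_prop) (.of_forall fun y => Real.abs_sin_le_one _)
  have e : ∀ y, expProfile σ y * Real.cos (k * (x + y))
      = expProfile σ y * Real.cos (k * y) * Real.cos (k * x)
        - expProfile σ y * Real.sin (k * y) * Real.sin (k * x) := fun y => by
    rw [mul_add, Real.cos_add]; ring
  have hs0 : ∫ y, expProfile σ y * Real.sin (k * y) = 0 := by
    have h := integral_neg_eq_self (fun y => expProfile σ y * Real.sin (k * y)) volume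
    simp only [expProfile, abs_neg, mul_neg, Real.sin_neg, integral_neg] at h ⊢
    linarith
  have hc0 : ∫ y, expProfile σ y * Real.cos (k * y) = cosMultiplier σ k := by
    have h := integral_comp_abs (f := fun y => expProfile σ y * Real.cos (k * y))
    have e : ∀ y, expProfile σ |y| * Real.cos (k * |y|) = expProfile σ y * Real.cos (k * y) := by
      intro y
      rcases abs_cases y with ⟨h, -⟩ | ⟨h, -⟩ <;> simp [expProfile, h]
    simp only [e] at h
    rw [h, integral_Ioi_expProfile_mul_cos hσ]
    ring
  simp only [e]
  rw [integral_sub (hc.mul_const _) (hs.mul_const _), integral_mul_const, integral_mul_const,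
    hs0, hc0]
  ring

theorem abs_cosMultiplier_le {σ : ℝ} (hσ : |σ| ≤ 1) (k : ℝ) :
    |cosMultiplier σ k| ≤ (1 + k ^ 2)⁻¹ := by
  have hk : 0 < 1 + k ^ 2 := by positivity
  have h1 : |(1 - k ^ 2) / (1 + k ^ 2) ^ 2| ≤ (1 + k ^ 2)⁻¹ := by
    rw [abs_div, abs_of_pos (pow_pos hk 2), div_le_iff₀ (pow_pos hk 2)]
    have : (1 + k ^ 2)⁻¹ * (1 + k ^ 2) ^ 2 = 1 + k ^ 2 := by field_simp
    rw [this, abs_le]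
    constructor <;> nlinarith [sq_nonneg k]
  have h2 : |σ * ((1 - k ^ 2) / (1 + k ^ 2) ^ 2)| ≤ (1 + k ^ 2)⁻¹ := by
    rw [abs_mul]
    exact (mul_le_of_le_one_left (abs_nonneg _) hσ).trans h1
  rw [cosMultiplier, abs_div, abs_two, div_le_iff₀ two_pos]
  refine (abs_add_le _ _).trans ?_
  rw [abs_of_pos (by positivity : 0 < 1 / (1 + k ^ 2)), one_div]
  linarith

theorem integrable_cosMultiplier {σ : ℝ} (hσ : |σ| ≤ 1) : Integrable (cosMultiplier σ) :=
  integrable_of_decay (D := 1) (continuous_cosMultiplier σ) fun k => by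
    simpa using abs_cosMultiplier_le hσ k

/-- The Fresnel integral of a cosine against one of the two multipliers. -/
noncomputable def fresnelCos (σ τ x : ℝ) : ℂ :=
  ∫ k in Ioi (0 : ℝ), Complex.exp (I * τ * k ^ 2 / 2) * (cosMultiplier σ k * Real.cos (k * x) : ℝ)

/-- Leading term of the Fresnel integral, with an error that is one power of `τ` better. -/
theorem norm_fresnelCos_sub_le {σ τ : ℝ} (hσ : |σ| ≤ 1) (hτ : τ ≠ 0) (x : ℝ) :
    ‖fresnelCos σ τ x - ((Real.pi : ℂ) / (-(I * τ / 2))) ^ (1 / 2 : ℂ) / 2 * cosMultiplier σ 0‖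
      ≤ 2000 * √(2 * Real.pi / |τ|) / |τ| * (1 + x ^ 2) := by
  have hP := integrable_expProfile hσ
  have hG := fun k => (integral_expProfile_mul_cos hσ k x).symm
  have hGi : IntegrableOn (fun k => cosMultiplier σ k * Real.cos (k * x)) (Ioi 0) :=
    ((integrable_cosMultiplier hσ).mul_bdd (c := 1) (by fun_prop)
      (.of_forall fun y => Real.abs_cos_le_one _)).integrableOn
  have h0 : (cosMultiplier σ 0 : ℂ) = ∫ y, (expProfile σ y : ℂ) := by
    rw [integral_complex_ofReal]
    simpa using (integral_expProfile_mul_cos hσ 0 0).symm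
  have hre : ∀ y : ℝ, Complex.exp (-((x + y : ℝ) : ℂ) ^ 2 / (4 * (-(I * τ / 2))))
      = Complex.exp (I * ((-((x + y) ^ 2 / (2 * τ)) : ℝ) : ℂ)) := by
    intro y
    congr 1
    have : (τ : ℂ) ≠ 0 := by exact_mod_cast hτ
    push_cast
    field_simp
    linear_combination 4 * ((x : ℂ) + y) ^ 2 * Complex.I_sq
  have hPe : Integrable fun y => (expProfile σ y : ℂ)
      * Complex.exp (I * ((-((x + y) ^ 2 / (2 * τ)) : ℝ) : ℂ)) := by
    refine hP.ofReal.mul_bdd (c := 1) (by fun_prop) (.of_forall fun y => ?_)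
    rw [Complex.norm_exp_I_mul_ofReal]
  have hPc : Integrable fun y => (expProfile σ y : ℂ) := hP.ofReal
  have hm := integral_fresnel_mul_cosTransform hτ hP (z := fun y => x + y) (by fun_prop) hG hGi
  simp only [hre] at hm
  rw [fresnelCos, hm, h0, ← mul_sub, ← integral_sub hPe hPc, norm_mul, norm_div,
    norm_fresnel_const hτ]
  -- The leading term is the mass of the profile, which is the multiplier at `0`. Replacing the
  -- phase by `1` costs at most `(x+y)²/(2|τ|)`, which gives the extra power of `τ` and the weight
  -- `1 + x²`.
  have hbd : ‖∫ y, ((expProfile σ y : ℂ) * Complex.exp (I * ((-((x + y) ^ 2 / (2 * τ)) : ℝ) : ℂ))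
      - expProfile σ y)‖ ≤ ∫ y, (782 * (1 + x ^ 2) / |τ|) * (1 + y ^ 2)⁻¹ := by
    refine norm_integral_le_of_norm_le (integrable_inv_one_add_sq.const_mul _)
      (.of_forall fun y => ?_)
    have e : (expProfile σ y : ℂ) * Complex.exp (I * ((-((x + y) ^ 2 / (2 * τ)) : ℝ) : ℂ))
      - expProfile σ y = expProfile σ y *
        (Complex.exp (I * ((-((x + y) ^ 2 / (2 * τ)) : ℝ) : ℂ)) - 1) := by ring
    rw [e, norm_mul, Complex.norm_real, Real.norm_eq_abs]
    have h1 : ‖Complex.exp (I * ((-((x + y) ^ 2 / (2 * τ)) : ℝ) : ℂ)) - 1‖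
        ≤ (x + y) ^ 2 / (2 * |τ|) := by
      refine (Real.norm_exp_I_mul_ofReal_sub_one_le).trans_eq ?_
      rw [Real.norm_eq_abs, abs_neg, abs_div, abs_mul, abs_two, abs_of_nonneg (sq_nonneg _)]
    calc _ ≤ |expProfile σ y| * ((x + y) ^ 2 / (2 * |τ|)) := by gcongr
      _ = |expProfile σ y * (x + y) ^ 2| / (2 * |τ|) := by
        rw [abs_mul, abs_of_nonneg (sq_nonneg (x + y))]; ring
      _ ≤ (1564 * (1 + x ^ 2) * (1 + y ^ 2)⁻¹) / (2 * |τ|) := by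
        gcongr; exact expProfile_mul_sq_le hσ x y
      _ = _ := by ring
  rw [integral_const_mul, integral_univ_inv_one_add_sq] at hbd
  have hpi := Real.pi_lt_four
  have hτ' : 0 < |τ| := abs_pos.2 hτ
  calc √(2 * Real.pi / |τ|) / ‖(2 : ℂ)‖ * _
      ≤ √(2 * Real.pi / |τ|) / ‖(2 : ℂ)‖ * (782 * (1 + x ^ 2) / |τ| * 4) := by
        gcongr
        exact hbd.trans (by gcongr)
    _ = 1564 * √(2 * Real.pi / |τ|) / |τ| * (1 + x ^ 2) := by simp; ring
    _ ≤ _ := by gcongr; norm_num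


/-! ### Fast decay, integration by parts and the shifted tanh -/

/-- Continuous functions on the half line that are bounded by `M / (1 + x²)²`. -/
structure FastDecay (M : ℝ) (F : ℝ → ℝ) : Prop where
  cont : ContinuousOn F (Ioi 0)
  bound : ∀ x, 0 < x → |F x| ≤ M * (1 / (1 + x ^ 2) ^ 2)

namespace FastDecay

variable {M N : ℝ} {F G : ℝ → ℝ}

theorem nonneg (h : FastDecay M F) : 0 ≤ M := by
  have h1 := (abs_nonneg _).trans (h.bound 1 one_pos)
  exact nonneg_of_mul_nonneg_left h1 (by norm_num)

theorem add (hF : FastDecay M F) (hG : FastDecay N G) : FastDecay (M + N) fun x => F x + G x :=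
  ⟨hF.cont.add hG.cont, fun x hx => (abs_add_le _ _).trans <| by
    rw [add_mul]; exact add_le_add (hF.bound x hx) (hG.bound x hx)⟩

theorem mul_left {c : ℝ} (hF : FastDecay M F) (hG : ContinuousOn G (Ioi 0))
    (hb : ∀ x, 0 < x → |G x| ≤ c) : FastDecay (c * M) fun x => G x * F x :=
  ⟨hG.mul hF.cont, fun x hx => by
    rw [abs_mul, mul_assoc]
    exact mul_le_mul (hb x hx) (hF.bound x hx) (abs_nonneg _) ((abs_nonneg _).trans (hb x hx))⟩

theorem const_mul (hF : FastDecay M F) (c : ℝ) : FastDecay (|c| * M) fun x => c * F x :=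
  hF.mul_left continuousOn_const fun _ _ => le_rfl

/-- One power of `1 + x²` in the decay pays for the growth of the multiplier and the other keeps
integrability. The general `E` serves both real kernels and complex Fresnel remainders. -/
theorem norm_mul_le {E : Type*} [NormedRing E] [NormedAlgebra ℝ E] [NormOneClass E] {g : E} {x c : ℝ}
    (hF : FastDecay M F) (hx : 0 < x) (hb : ‖g‖ ≤ c * (1 + x ^ 2)) :
    ‖g * algebraMap ℝ E (F x)‖ ≤ c * M * (1 + x ^ 2)⁻¹ := by
  refine (_root_.norm_mul_le _ _).trans ?_
  rw [norm_algebraMap', Real.norm_eq_abs]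
  calc ‖g‖ * |F x| ≤ c * (1 + x ^ 2) * (M * (1 / (1 + x ^ 2) ^ 2)) :=
        mul_le_mul hb (hF.bound x hx) (abs_nonneg _) ((norm_nonneg _).trans hb)
    _ = _ := by field_simp

theorem integrableOn_mul {E : Type*} [NormedRing E] [NormedAlgebra ℝ E] [NormOneClass E] {g : ℝ → E}
    {c : ℝ} (hF : FastDecay M F) (hg : AEStronglyMeasurable g (volume.restrict (Ioi 0)))
    (hb : ∀ x, 0 < x → ‖g x‖ ≤ c * (1 + x ^ 2)) :
    IntegrableOn (fun x => g x * algebraMap ℝ E (F x)) (Ioi 0) := by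
  refine (integrable_inv_one_add_sq.integrableOn.const_mul (c * M)).mono'
    (hg.mul ((continuous_algebraMap ℝ E).comp_aestronglyMeasurable
      (hF.cont.aestronglyMeasurable measurableSet_Ioi))) ?_
  filter_upwards [ae_restrict_mem measurableSet_Ioi] with x hx
  exact hF.norm_mul_le hx (hb x hx)

theorem norm_integral_mul_le {E : Type*} [NormedRing E] [NormedAlgebra ℝ E] [NormOneClass E]
    {g : ℝ → E} {c : ℝ} (hF : FastDecay M F) (hc : 0 ≤ c)
    (hb : ∀ x, 0 < x → ‖g x‖ ≤ c * (1 + x ^ 2)) :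
    ‖∫ x in Ioi 0, g x * algebraMap ℝ E (F x)‖ ≤ 2 * c * M := by
  have h : ‖∫ x in Ioi 0, g x * algebraMap ℝ E (F x)‖
      ≤ ∫ x in Ioi (0 : ℝ), c * M * (1 + x ^ 2)⁻¹ := by
    refine norm_integral_le_of_norm_le (integrable_inv_one_add_sq.integrableOn.const_mul (c * M)) ?_
    filter_upwards [ae_restrict_mem measurableSet_Ioi] with x hx
    exact hF.norm_mul_le hx (hb x hx)
  rw [integral_const_mul, integral_Ioi_inv_one_add_sq, Real.arctan_zero, sub_zero] at h
  have := Real.pi_lt_four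
  have := mul_nonneg hc hF.nonneg
  nlinarith

theorem integrableOn (hF : FastDecay M F) : IntegrableOn F (Ioi 0) := by
  have h := hF.integrableOn_mul (g := fun _ => (1 : ℝ)) (c := 1) aestronglyMeasurable_const
    fun x _ => by simp; positivity
  simpa using h

theorem abs_integral_le (hF : FastDecay M F) : |∫ x in Ioi 0, F x| ≤ 2 * M := by
  have h := hF.norm_integral_mul_le (g := fun _ => (1 : ℝ)) zero_le_one
    fun x _ => by simp; positivity
  simpa using h

theorem abs_le (hF : FastDecay M F) {x : ℝ} (hx : 0 < x) : |F x| ≤ M :=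
  (hF.bound x hx).trans (mul_le_of_le_one_right hF.nonneg
    ((one_div_sq_le_inv x).trans (inv_le_one_of_one_le₀ (by nlinarith [sq_nonneg x]))))

theorem tendsto (hF : FastDecay M F) : Tendsto F atTop (𝓝 0) := by
  have h : Tendsto (fun x : ℝ => M * (1 + x ^ 2)⁻¹) atTop (𝓝 0) := by
    have : Tendsto (fun x : ℝ => 1 + x ^ 2) atTop atTop :=
      tendsto_atTop_add_const_left _ _ (tendsto_pow_atTop two_ne_zero)
    simpa using this.inv_tendsto_atTop.const_mul M
  refine squeeze_zero_norm' ?_ h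
  filter_upwards [eventually_gt_atTop 0] with x hx
  exact (hF.bound x hx).trans (mul_le_mul_of_nonneg_left (one_div_sq_le_inv x) hF.nonneg)

end FastDecay

theorem tendsto_mul_of_bounded {l : Filter ℝ} {f g : ℝ → ℝ} {c : ℝ} (hf : Tendsto f l (𝓝 0))
    (hg : ∀ᶠ x in l, |g x| ≤ c) : Tendsto (fun x => f x * g x) l (𝓝 0) :=
  hf.zero_mul_isBoundedUnder_le (isBoundedUnder_of_eventually_le hg)

/-- Integration by parts on the half line, with boundary terms that vanish. -/
theorem integral_deriv_trig_eq_zero {M₁ M₂ M₃ M₄ : ℝ} {A A' B B' : ℝ → ℝ} (hA : FastDecay M₁ A)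
    (hA' : FastDecay M₂ A') (hB : FastDecay M₃ B) (hB' : FastDecay M₄ B')
    (dA : ∀ x, 0 < x → HasDerivAt A (A' x) x) (dB : ∀ x, 0 < x → HasDerivAt B (B' x) x) (k : ℝ) :
    IntegrableOn (fun x => (1 - Real.cos (k * x)) * A' x + k * Real.sin (k * x) * A x
        + (Real.sin (k * x) * B' x + k * Real.cos (k * x) * B x)) (Ioi 0) ∧
      ∫ x in Ioi (0 : ℝ), ((1 - Real.cos (k * x)) * A' x + k * Real.sin (k * x) * A x
        + (Real.sin (k * x) * B' x + k * Real.cos (k * x) * B x)) = 0 := by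
  have hs : ∀ y, HasDerivAt (fun y => Real.sin (k * y)) (k * Real.cos (k * y)) y := fun y => by
    simpa [mul_comm] using ((hasDerivAt_id y).const_mul k).sin
  have hc : ∀ y, HasDerivAt (fun y => 1 - Real.cos (k * y)) (k * Real.sin (k * y)) y := fun y => by
    simpa [mul_comm] using ((hasDerivAt_id y).const_mul k).cos.const_sub 1
  have b1 : ∀ x, |1 - Real.cos (k * x)| ≤ 2 := fun x => by
    rw [abs_le]; constructor <;> linarith [Real.cos_le_one (k * x), Real.neg_one_le_cos (k * x)]
  have b2 : ∀ x, |k * Real.sin (k * x)| ≤ |k| := fun x => by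
    rw [abs_mul]; exact mul_le_of_le_one_right (abs_nonneg k) (Real.abs_sin_le_one _)
  have b3 : ∀ x, |k * Real.cos (k * x)| ≤ |k| := fun x => by
    rw [abs_mul]; exact mul_le_of_le_one_right (abs_nonneg k) (Real.abs_cos_le_one _)
  -- The coefficients `1 - cos (k x)` and `sin (k x)` vanish at `x = 0`, so boundedness of `A` and
  -- `B` near `0` suffices and no boundary value is needed.
  set f : ℝ → ℝ := fun x => (1 - Real.cos (k * x)) * A x + Real.sin (k * x) * B x with hf
  have hd : ∀ x ∈ Ioi (0 : ℝ), HasDerivAt f ((1 - Real.cos (k * x)) * A' x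
      + k * Real.sin (k * x) * A x + (Real.sin (k * x) * B' x + k * Real.cos (k * x) * B x)) x := by
    intro x hx
    refine (((hc x).mul (dA x hx)).add ((hs x).mul (dB x hx))).congr_deriv ?_
    ring
  have hi : IntegrableOn (fun x => (1 - Real.cos (k * x)) * A' x
      + k * Real.sin (k * x) * A x + (Real.sin (k * x) * B' x + k * Real.cos (k * x) * B x))
      (Ioi 0) := by
    refine Integrable.add (Integrable.add ?_ ?_) (Integrable.add ?_ ?_)
    · exact (hA'.mul_left (by fun_prop) fun x _ => b1 x).integrableOn
    · exact (hA.mul_left (by fun_prop) fun x _ => b2 x).integrableOn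
    · exact (hB'.mul_left (by fun_prop) fun x _ => Real.abs_sin_le_one _).integrableOn
    · exact (hB.mul_left (by fun_prop) fun x _ => b3 x).integrableOn
  have htop : Tendsto f atTop (𝓝 0) := by
    have h1 := (hA.mul_left (by fun_prop) fun x _ => b1 x).tendsto
    have h2 := (hB.mul_left (G := fun x => Real.sin (k * x)) (by fun_prop)
      fun x _ => Real.abs_sin_le_one _).tendsto
    simpa using h1.add h2
  have hzero : ContinuousWithinAt f (Ici 0) 0 := by
    rw [← continuousWithinAt_Ioi_iff_Ici]
    have e : f 0 = 0 := by simp [hf]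
    rw [ContinuousWithinAt, e]
    have c1 : Tendsto (fun x => 1 - Real.cos (k * x)) (𝓝[>] 0) (𝓝 0) := by
      have : Continuous fun x => 1 - Real.cos (k * x) := by fun_prop
      simpa using (this.tendsto 0).mono_left nhdsWithin_le_nhds
    have c2 : Tendsto (fun x => Real.sin (k * x)) (𝓝[>] 0) (𝓝 0) := by
      have : Continuous fun x => Real.sin (k * x) := by fun_prop
      simpa using (this.tendsto 0).mono_left nhdsWithin_le_nhds
    have h1 := tendsto_mul_of_bounded c1
      (by filter_upwards [self_mem_nhdsWithin] with x hx using hA.abs_le hx)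
    have h2 := tendsto_mul_of_bounded c2
      (by filter_upwards [self_mem_nhdsWithin] with x hx using hB.abs_le hx)
    simpa using h1.add h2
  refine ⟨hi, ?_⟩
  rw [integral_Ioi_of_hasDerivAt_of_tendsto hzero hd hi htop]
  simp [hf]

theorem hasDerivAt_tanh (x : ℝ) : HasDerivAt Real.tanh (1 - Real.tanh x ^ 2) x := by
  have h := Real.cosh_pos x
  rw [show Real.tanh = fun y => Real.sinh y / Real.cosh y from funext Real.tanh_eq_sinh_div_cosh]
  refine ((Real.hasDerivAt_sinh x).div (Real.hasDerivAt_cosh x) h.ne').congr_deriv ?_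
  field_simp

theorem continuous_tanh : Continuous Real.tanh :=
  continuous_iff_continuousAt.2 fun x => (hasDerivAt_tanh x).continuousAt

theorem tanh_add_mul (x y : ℝ) :
    Real.tanh (x + y) * (1 + Real.tanh x * Real.tanh y) = Real.tanh x + Real.tanh y := by
  have h1 := (Real.cosh_pos x).ne'
  have h2 := (Real.cosh_pos y).ne'
  have h3 := (Real.cosh_pos (x + y)).ne'
  simp only [Real.tanh_eq_sinh_div_cosh]
  field_simp
  rw [Real.cosh_add, Real.sinh_add]
  ring

/-- By the addition formula the difference times `1 + q tanh x ≥ 1/2` equals `q (1 - tanh² x)`. -/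
theorem abs_tanh_add_theta_sub_le {q : ℝ} (hq : |q| < 1 / 2) (x : ℝ) :
    |Real.tanh (x + theta q) - Real.tanh x| ≤ 2 * |q| := by
  have h := tanh_add_mul x (theta q)
  rw [tanh_theta (hq.trans (by norm_num))] at h
  have hx := Real.abs_tanh_lt_one x
  have hx2 := Real.tanh_sq_lt_one x
  have hTq : |Real.tanh x * q| ≤ 1 / 2 := by
    rw [abs_mul]; nlinarith [abs_nonneg q, abs_nonneg (Real.tanh x)]
  have hpos : 1 / 2 ≤ 1 + Real.tanh x * q := by linarith [neg_abs_le (Real.tanh x * q)]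
  have e : (Real.tanh (x + theta q) - Real.tanh x) * (1 + Real.tanh x * q)
      = q * (1 - Real.tanh x ^ 2) := by linear_combination h
  have e2 := congrArg abs e
  rw [abs_mul, abs_mul, abs_of_pos (by linarith : 0 < 1 + Real.tanh x * q),
    abs_of_nonneg (by linarith : 0 ≤ 1 - Real.tanh x ^ 2)] at e2
  nlinarith [abs_nonneg (Real.tanh (x + theta q) - Real.tanh x), abs_nonneg q,
    sq_nonneg (Real.tanh x)]


/-! ### Replacing the transform by its `q = 0` form -/

/-- The cosine transform on the half line. -/
noncomputable def cosTransform (Ψ : ℝ → ℝ) (k : ℝ) : ℝ :=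
  ∫ x in Ioi (0 : ℝ), Real.cos (k * x) * Ψ x

/-- The function `2 (tanh · w)' + w''`, where `w₁ = w'` and `w₂ = w''`. -/
noncomputable def sourceTerm (w w₁ w₂ : ℝ → ℝ) (x : ℝ) : ℝ :=
  2 * ((1 - Real.tanh x ^ 2) * w x + Real.tanh x * w₁ x) + w₂ x

/-- The transform against `kernel 0`, after integrations by parts. -/
noncomputable def freeTransform (w w₁ w₂ : ℝ → ℝ) (k : ℝ) : ℝ :=
  cosTransform (fun x => w x + sourceTerm w w₁ w₂ x) k - ∫ x in Ioi (0 : ℝ), sourceTerm w w₁ w₂ x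

theorem abs_one_sub_cos_le (x : ℝ) : |1 - Real.cos x| ≤ 2 := by
  rw [abs_le]; constructor <;> linarith [Real.cos_le_one x, Real.neg_one_le_cos x]

theorem abs_one_sub_tanh_sq_le (x : ℝ) : |1 - Real.tanh x ^ 2| ≤ 1 := by
  rw [abs_le]
  constructor <;> linarith [Real.tanh_sq_lt_one x, sq_nonneg (Real.tanh x)]

section

variable {Q : ℝ} {w w₁ w₂ : ℝ → ℝ}

theorem FastDecay.tanh_deriv (h : FastDecay Q w) (h₁ : FastDecay Q w₁) (c : ℝ) :
    FastDecay (4 * Q) fun x => 2 * ((1 - Real.tanh (x + c) ^ 2) * w x + Real.tanh (x + c) * w₁ x) := by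
  have := continuous_tanh
  have e := ((h.mul_left (G := fun x => 1 - Real.tanh (x + c) ^ 2) (by fun_prop)
    fun x _ => abs_one_sub_tanh_sq_le _).add
    (h₁.mul_left (G := fun x => Real.tanh (x + c)) (by fun_prop)
      fun x _ => (Real.abs_tanh_lt_one _).le)).const_mul 2
  rwa [abs_two, show 2 * (1 * Q + 1 * Q) = 4 * Q by ring] at e

theorem FastDecay.sourceTerm (h : FastDecay Q w) (h₁ : FastDecay Q w₁) (h₂ : FastDecay Q w₂) :
    FastDecay (5 * Q) (sourceTerm w w₁ w₂) := by
  have e := (h.tanh_deriv h₁ 0).add h₂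
  simp only [add_zero] at e
  rwa [show 4 * Q + Q = 5 * Q by ring] at e

theorem abs_cosTransform_le {M : ℝ} {Ψ : ℝ → ℝ} (h : FastDecay M Ψ) (k : ℝ) :
    |cosTransform Ψ k| ≤ 2 * M := by
  have e := (h.mul_left (G := fun x => Real.cos (k * x)) (by fun_prop)
    fun x _ => Real.abs_cos_le_one _).abs_integral_le
  rwa [one_mul] at e

theorem abs_freeTransform_le (h : FastDecay Q w) (h₁ : FastDecay Q w₁) (h₂ : FastDecay Q w₂)
    (k : ℝ) : |freeTransform w w₁ w₂ k| ≤ 22 * Q := by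
  have hs := h.sourceTerm h₁ h₂
  refine (abs_sub _ _).trans ?_
  have e1 := abs_cosTransform_le (h.add hs) k
  have e2 := hs.abs_integral_le
  linarith

theorem aestronglyMeasurable_cosTransform {M : ℝ} {Ψ : ℝ → ℝ} (h : FastDecay M Ψ) :
    AEStronglyMeasurable (cosTransform Ψ) (volume.restrict (Ioi 0)) := by
  have hm : AEStronglyMeasurable (fun p : ℝ × ℝ => Real.cos (p.1 * p.2) * Ψ p.2)
      ((volume.restrict (Ioi 0)).prod (volume.restrict (Ioi 0))) :=
    (by fun_prop : Continuous fun p : ℝ × ℝ => Real.cos (p.1 * p.2)).aestronglyMeasurable.mul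
      (h.cont.aestronglyMeasurable measurableSet_Ioi).comp_snd
  exact hm.integral_prod_right'

theorem aestronglyMeasurable_kernelTransform (q : ℝ) (h : FastDecay Q w) :
    AEStronglyMeasurable (kernelTransform q w) (volume.restrict (Ioi 0)) := by
  have hT := continuous_tanh.measurable
  have hm : AEStronglyMeasurable (fun p : ℝ × ℝ => kernel q p.1 p.2 * w p.2)
      ((volume.restrict (Ioi 0)).prod (volume.restrict (Ioi 0))) := by
    refine AEStronglyMeasurable.mul ?_ (h.cont.aestronglyMeasurable measurableSet_Ioi).comp_snd
    refine Measurable.aestronglyMeasurable ?_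
    unfold kernel
    fun_prop
  exact hm.integral_prod_right'

theorem continuous_kernel (q k : ℝ) : Continuous (kernel q k) := by
  have := continuous_tanh
  unfold kernel
  fun_prop

theorem abs_sin_div_le {k x : ℝ} (hk : 0 < k) (hx : 0 < x) : |Real.sin (k * x) / k| ≤ x := by
  rw [abs_div, abs_of_pos hk, div_le_iff₀ hk]
  have h := Real.abs_sin_le_abs (x := k * x)
  rw [abs_of_pos (mul_pos hk hx)] at h
  linarith

theorem le_one_add_sq (x : ℝ) : x ≤ 1 + x ^ 2 := by nlinarith [sq_nonneg (x - 1)]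

theorem abs_kernel_le {q k x : ℝ} (hk : 0 < k) (hx : 0 < x) :
    |kernel q k x| ≤ (|q * (1 - k ^ 2)| + 2 * k ^ 2 + (|1 - k ^ 2| + 2 * |q|)) * (1 + x ^ 2) := by
  have hT := (Real.abs_tanh_lt_one (x + theta q)).le
  have h1 : |q * (1 - k ^ 2) + 2 * k ^ 2 * Real.tanh (x + theta q)|
      ≤ |q * (1 - k ^ 2)| + 2 * k ^ 2 := by
    refine (abs_add_le _ _).trans ?_
    rw [abs_mul (2 * k ^ 2), abs_of_nonneg (by positivity : 0 ≤ 2 * k ^ 2)]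
    exact add_le_add le_rfl (mul_le_of_le_one_right (by positivity) hT)
  have h2 : |1 - k ^ 2 - 2 * q * Real.tanh (x + theta q)| ≤ |1 - k ^ 2| + 2 * |q| := by
    refine (abs_sub _ _).trans ?_
    rw [abs_mul (2 * q), abs_mul, abs_two]
    exact add_le_add le_rfl (mul_le_of_le_one_right (by positivity) hT)
  have hxx := le_one_add_sq x
  have h3 : |Real.cos (k * x)| ≤ 1 + x ^ 2 := (Real.abs_cos_le_one _).trans (by nlinarith)
  unfold kernel
  refine (abs_add_le _ _).trans ?_
  rw [abs_mul, abs_mul, add_mul]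
  have h4 := (abs_sin_div_le hk hx).trans hxx
  gcongr

theorem integrableOn_kernel_mul {q k : ℝ} (hk : 0 < k) (h : FastDecay Q w) :
    IntegrableOn (fun x => kernel q k x * w x) (Ioi 0) :=
  h.integrableOn_mul (continuous_kernel q k).aestronglyMeasurable fun _ hx => abs_kernel_le hk hx

/-- The transform against `kernel q` differs from that against `kernel 0` by `O(q)`, uniformly
in the frequency. -/
theorem abs_kernelTransform_sub_freeTransform_le {q k : ℝ} (hq : |q| < 1 / 2) (hk : 0 < k)
    (h : FastDecay Q w) (h₁ : FastDecay Q w₁) (h₂ : FastDecay Q w₂)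
    (d : ∀ x, 0 < x → HasDerivAt w (w₁ x) x) (d₁ : ∀ x, 0 < x → HasDerivAt w₁ (w₂ x) x) :
    |kernelTransform q w k - freeTransform w w₁ w₂ k| ≤ 58 * |q| * Q := by
  have hT := continuous_tanh
  have hQ := h.nonneg
  have hqn := abs_nonneg q
  set T : ℝ → ℝ := fun x => Real.tanh (x + theta q) with hTdef
  have hTc : Continuous T := by fun_prop
  have hTb : ∀ x, |T x| ≤ 1 := fun x => (Real.abs_tanh_lt_one _).le
  have dT : ∀ x, HasDerivAt T (1 - T x ^ 2) x := fun x =>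
    (DeltaNLS.hasDerivAt_tanh (x + theta q)).comp_add_const x (theta q)
  -- The coefficients of `w` and `w₁` left in the difference after integration by parts. The powers
  -- of `k` are gone, and each is `O(q)` up to the weight `1 + x²`; the final constant is `58 = 2·19
  -- + 2·10`.
  set g₁ : ℝ → ℝ := fun x => q * (Real.sin (k * x) / k) - 2 * q * T x * Real.cos (k * x)
    + 2 * (1 - Real.cos (k * x)) * (T x ^ 2 - Real.tanh x ^ 2) with hg₁
  set g₂ : ℝ → ℝ := fun x => (1 - Real.cos (k * x)) * (q - 2 * (T x - Real.tanh x)) with hg₂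
  have c₁ : Continuous g₁ := by fun_prop
  have c₂ : Continuous g₂ := by fun_prop
  have b₁ : ∀ x, 0 < x → ‖g₁ x‖ ≤ 19 * |q| * (1 + x ^ 2) := by
    intro x hx
    have e1 : |q * (Real.sin (k * x) / k)| ≤ |q| * (1 + x ^ 2) := by
      rw [abs_mul]; gcongr; exact (abs_sin_div_le hk hx).trans (le_one_add_sq x)
    have e2 : |2 * q * T x * Real.cos (k * x)| ≤ 2 * |q| := by
      rw [abs_mul, abs_mul, abs_mul, abs_two]
      have := hTb x
      have := Real.abs_cos_le_one (k * x)
      calc 2 * |q| * |T x| * |Real.cos (k * x)| ≤ 2 * |q| * 1 * 1 := by gcongr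
        _ = _ := by ring
    have e3 : |2 * (1 - Real.cos (k * x)) * (T x ^ 2 - Real.tanh x ^ 2)| ≤ 16 * |q| := by
      rw [sq_sub_sq, abs_mul, abs_mul, abs_mul, abs_two]
      have e4 : |T x + Real.tanh x| ≤ 2 := (abs_add_le _ _).trans (by
        linarith [hTb x, Real.abs_tanh_lt_one x])
      calc 2 * |1 - Real.cos (k * x)| * (|T x + Real.tanh x| * |T x - Real.tanh x|)
          ≤ 2 * 2 * (2 * (2 * |q|)) := by
            gcongr
            · exact abs_one_sub_cos_le _
            · exact abs_tanh_add_theta_sub_le hq x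
        _ = _ := by ring
    have := abs_add_le (q * (Real.sin (k * x) / k) - 2 * q * T x * Real.cos (k * x))
      (2 * (1 - Real.cos (k * x)) * (T x ^ 2 - Real.tanh x ^ 2))
    have := abs_sub (q * (Real.sin (k * x) / k)) (2 * q * T x * Real.cos (k * x))
    rw [Real.norm_eq_abs]
    nlinarith [mul_nonneg hqn (sq_nonneg x)]
  have b₂ : ∀ x, 0 < x → ‖g₂ x‖ ≤ 10 * |q| * (1 + x ^ 2) := by
    intro x hx
    have e1 : |q - 2 * (T x - Real.tanh x)| ≤ 5 * |q| := by
      refine (abs_sub _ _).trans ?_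
      rw [abs_mul, abs_two]
      linarith [abs_tanh_add_theta_sub_le hq x]
    rw [Real.norm_eq_abs, abs_mul]
    calc _ ≤ 2 * (5 * |q|) := by
          gcongr
          exact abs_one_sub_cos_le _
      _ ≤ _ := by nlinarith [mul_nonneg hqn (sq_nonneg x)]
  have i₁ : IntegrableOn (fun x => g₁ x * w x) (Ioi 0) :=
    h.integrableOn_mul c₁.aestronglyMeasurable b₁
  have i₂ : IntegrableOn (fun x => g₂ x * w₁ x) (Ioi 0) :=
    h₁.integrableOn_mul c₂.aestronglyMeasurable b₂
  have n₁ : |∫ x in Ioi 0, g₁ x * w x| ≤ 2 * (19 * |q|) * Q :=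
    h.norm_integral_mul_le (by positivity) b₁
  have n₂ : |∫ x in Ioi 0, g₂ x * w₁ x| ≤ 2 * (10 * |q|) * Q :=
    h₁.norm_integral_mul_le (by positivity) b₂
  have hΦ := h.sourceTerm h₁ h₂
  have hΨ := (h.add hΦ).mul_left (G := fun x => Real.cos (k * x)) (by fun_prop)
    fun x _ => Real.abs_cos_le_one _
  -- With `A = -q w + 2 T w + w₁` and `B = -k w`, the terms `k sin (k x) A + k cos (k x) B + sin (k
  -- x) B'` are exactly the part of `kernel q k x * w x` that grows with `k`; the `w₁` terms cancel.
  have hA := ((h.const_mul (-q)).add (((h.mul_left (G := T) (by fun_prop) fun x _ => hTb x).const_mul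
    2).add h₁))
  have hA' := ((h₁.const_mul (-q)).add ((h.tanh_deriv h₁ (theta q)).add h₂))
  have hB := h.const_mul (-k)
  have hB' := h₁.const_mul (-k)
  obtain ⟨hzi, hz⟩ := integral_deriv_trig_eq_zero hA hA' hB hB'
    (fun x hx => by
      refine (((d x hx).const_mul (-q)).add ((((dT x).mul (d x hx)).const_mul 2).add
        (d₁ x hx))).congr_deriv ?_
      simp [hTdef])
    (fun x hx => (d x hx).const_mul (-k)) k
  have key : kernelTransform q w k - freeTransform w w₁ w₂ k
      = (∫ x in Ioi 0, g₁ x * w x) + ∫ x in Ioi 0, g₂ x * w₁ x := by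
    have i₃ : IntegrableOn (fun x => g₁ x * w x + g₂ x * w₁ x) (Ioi 0) := i₁.add i₂
    have i₄ : IntegrableOn (fun x => Real.cos (k * x) * (w x + sourceTerm w w₁ w₂ x)
      - sourceTerm w w₁ w₂ x) (Ioi 0) := hΨ.integrableOn.sub hΦ.integrableOn
    have e := integral_add (i₃.add i₄) hzi
    rw [hz, add_zero, integral_add' i₃ i₄, integral_add i₁ i₂,
      integral_sub hΨ.integrableOn hΦ.integrableOn] at e
    rw [freeTransform, cosTransform, sub_eq_iff_eq_add, ← e]
    refine integral_congr_ae (.of_forall fun x => ?_)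
    simp only [kernel, sourceTerm, hg₁, hg₂, hTdef, Pi.add_apply]
    field_simp
    ring
  rw [key]
  refine (abs_add_le _ _).trans ?_
  linarith

end


/-! ### Fresnel asymptotics of the transforms -/

theorem norm_fresnel_phase (τ k : ℝ) : ‖Complex.exp (I * τ * k ^ 2 / 2)‖ = 1 := by
  have : I * τ * k ^ 2 / 2 = I * ((τ * k ^ 2 / 2 : ℝ) : ℂ) := by push_cast; ring
  rw [this, Complex.norm_exp_I_mul_ofReal]

theorem integrableOn_fresnel_mul {τ : ℝ} {g : ℝ → ℝ} (hg : IntegrableOn g (Ioi 0)) :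
    IntegrableOn (fun k : ℝ => Complex.exp (I * τ * k ^ 2 / 2) * (g k : ℂ)) (Ioi 0) :=
  hg.ofReal.bdd_mul (c := 1) (by fun_prop) (.of_forall fun k => (norm_fresnel_phase τ k).le)

/-- The scale `t^(-3/2)` of the remainder in the Fresnel asymptotics. -/
noncomputable def fresnelError (τ : ℝ) : ℝ := 2000 * √(2 * Real.pi / |τ|) / |τ|

theorem fresnelError_nonneg (τ : ℝ) : 0 ≤ fresnelError τ := by
  unfold fresnelError; positivity

section

variable {σ τ : ℝ}

/-- Fubini turns the integral into one of `fresnelCos σ τ x` against `Ψ`. The leading term of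
`fresnelCos` does not depend on `x`, and the decay of `Ψ` absorbs the weight `1 + x²` of its error.
-/
theorem norm_integral_fresnel_cosTransform_sub_le (hσ : |σ| ≤ 1) (hτ : τ ≠ 0) {M : ℝ} {Ψ : ℝ → ℝ}
    (h : FastDecay M Ψ) :
    ‖(∫ k in Ioi (0 : ℝ), Complex.exp (I * τ * k ^ 2 / 2)
        * (cosMultiplier σ k * cosTransform Ψ k : ℝ))
      - ((Real.pi : ℂ) / (-(I * τ / 2))) ^ (1 / 2 : ℂ) / 2 * cosMultiplier σ 0
        * (∫ x in Ioi (0 : ℝ), Ψ x : ℝ)‖ ≤ 2 * fresnelError τ * M := by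
  set L := ((Real.pi : ℂ) / (-(I * τ / 2))) ^ (1 / 2 : ℂ) / 2 * cosMultiplier σ 0 with hL
  have hint : Integrable (fun p : ℝ × ℝ => Complex.exp (I * τ * p.1 ^ 2 / 2)
      * (cosMultiplier σ p.1 : ℂ) * (Ψ p.2 : ℂ) * Real.cos (p.1 * p.2))
      ((volume.restrict (Ioi 0)).prod (volume.restrict (Ioi 0))) := by
    refine ((integrableOn_fresnel_mul (integrable_cosMultiplier hσ).integrableOn).mul_prod
      h.integrableOn.ofReal).mul_bdd (c := 1) (by fun_prop) (.of_forall fun p => ?_)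
    rw [Complex.norm_real]
    exact Real.abs_cos_le_one _
  have e : ∀ x, ∫ k in Ioi (0 : ℝ), Complex.exp (I * τ * k ^ 2 / 2) * (cosMultiplier σ k : ℂ)
      * (Ψ x : ℂ) * Real.cos (k * x) = fresnelCos σ τ x * Ψ x := by
    intro x
    rw [fresnelCos, ← integral_mul_const]
    congr 1; ext k
    push_cast; ring
  have hΨ : IntegrableOn (fun x => L * (Ψ x : ℂ)) (Ioi 0) := h.integrableOn.ofReal.const_mul L
  have hF : IntegrableOn (fun x => fresnelCos σ τ x * (Ψ x : ℂ)) (Ioi 0) := by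
    have := hint.integral_prod_right
    simp only [e] at this
    exact this
  have key : (∫ k in Ioi (0 : ℝ), Complex.exp (I * τ * k ^ 2 / 2)
        * (cosMultiplier σ k * cosTransform Ψ k : ℝ)) - L * (∫ x in Ioi (0 : ℝ), Ψ x : ℝ)
      = ∫ x in Ioi (0 : ℝ), (fresnelCos σ τ x - L) * algebraMap ℝ ℂ (Ψ x) := by
    simp only [sub_mul, Complex.coe_algebraMap]
    rw [integral_sub hF hΨ, integral_const_mul, integral_complex_ofReal]
    congr 1
    simp only [← e]
    rw [← integral_integral_swap hint]
    congr 1; ext k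
    rw [cosTransform, Complex.ofReal_mul, ← integral_complex_ofReal, ← mul_assoc,
      ← integral_const_mul]
    congr 1; ext x
    push_cast; ring
  rw [key]
  exact h.norm_integral_mul_le (fresnelError_nonneg τ) fun x _ => norm_fresnelCos_sub_le hσ hτ x

theorem integrableOn_cosMultiplier_mul (hσ : |σ| ≤ 1) {g : ℝ → ℝ} {c : ℝ}
    (hg : AEStronglyMeasurable g (volume.restrict (Ioi 0))) (hb : ∀ k, |g k| ≤ c) :
    IntegrableOn (fun k => cosMultiplier σ k * g k) (Ioi 0) :=
  (integrable_cosMultiplier hσ).integrableOn.mul_bdd hg (.of_forall hb)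

variable {Q : ℝ} {w w₁ w₂ : ℝ → ℝ}

/-- The integral of `sourceTerm` enters once through the cosine transform and once with the opposite
sign as a constant, so only `∫ w` survives in the leading term. The errors add up to `22 = 2·6 +
2·5`. -/
theorem norm_integral_fresnel_freeTransform_sub_le (hσ : |σ| ≤ 1) (hτ : τ ≠ 0)
    (h : FastDecay Q w) (h₁ : FastDecay Q w₁) (h₂ : FastDecay Q w₂) :
    ‖(∫ k in Ioi (0 : ℝ), Complex.exp (I * τ * k ^ 2 / 2)
        * (cosMultiplier σ k * freeTransform w w₁ w₂ k : ℝ))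
      - ((Real.pi : ℂ) / (-(I * τ / 2))) ^ (1 / 2 : ℂ) / 2 * cosMultiplier σ 0
        * (∫ x in Ioi (0 : ℝ), w x : ℝ)‖ ≤ 22 * fresnelError τ * Q := by
  have hΦ := h.sourceTerm h₁ h₂
  have hΨ := h.add hΦ
  set L := ((Real.pi : ℂ) / (-(I * τ / 2))) ^ (1 / 2 : ℂ) / 2 * cosMultiplier σ 0 with hL
  set s : ℝ := ∫ x in Ioi (0 : ℝ), sourceTerm w w₁ w₂ x with hs
  have b1 := norm_integral_fresnel_cosTransform_sub_le hσ hτ hΨ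
  have b2 : ‖(fresnelCos σ τ 0 - L) * (s : ℂ)‖ ≤ fresnelError τ * (2 * (5 * Q)) := by
    rw [norm_mul, Complex.norm_real]
    have := norm_fresnelCos_sub_le hσ hτ 0
    refine mul_le_mul ?_ hΦ.abs_integral_le (norm_nonneg _) (fresnelError_nonneg τ)
    rwa [zero_pow two_ne_zero, add_zero, mul_one] at this
  have i1 := integrableOn_fresnel_mul (τ := τ) (integrableOn_cosMultiplier_mul hσ
    (aestronglyMeasurable_cosTransform hΨ) (abs_cosTransform_le hΨ))
  have i2 := integrableOn_fresnel_mul (τ := τ)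
    ((integrable_cosMultiplier hσ).integrableOn.mul_const s)
  have e : (∫ k in Ioi (0 : ℝ), Complex.exp (I * τ * k ^ 2 / 2)
        * (cosMultiplier σ k * freeTransform w w₁ w₂ k : ℝ))
      = (∫ k in Ioi (0 : ℝ), Complex.exp (I * τ * k ^ 2 / 2)
        * (cosMultiplier σ k * cosTransform (fun x => w x + sourceTerm w w₁ w₂ x) k : ℝ))
        - fresnelCos σ τ 0 * s := by
    rw [fresnelCos, ← integral_mul_const]
    have : ∀ k : ℝ, Complex.exp (I * τ * k ^ 2 / 2) * ((cosMultiplier σ k * Real.cos (k * 0) : ℝ) : ℂ)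
        * s = Complex.exp (I * τ * k ^ 2 / 2) * ((cosMultiplier σ k * s : ℝ) : ℂ) := fun k => by
      push_cast; simp; ring
    simp only [this]
    rw [← integral_sub i1 i2]
    congr 1; ext k
    rw [freeTransform]
    push_cast; ring
  have e2 : ((∫ x in Ioi (0 : ℝ), (w x + sourceTerm w w₁ w₂ x) : ℝ) : ℂ)
      = (∫ x in Ioi (0 : ℝ), w x : ℝ) + s := by
    rw [integral_add h.integrableOn hΦ.integrableOn]; push_cast; rfl
  rw [e2] at b1
  rw [e]
  calc _ = ‖((∫ k in Ioi (0 : ℝ), Complex.exp (I * τ * k ^ 2 / 2)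
        * (cosMultiplier σ k * cosTransform (fun x => w x + sourceTerm w w₁ w₂ x) k : ℝ))
        - L * ((∫ x in Ioi (0 : ℝ), w x : ℝ) + s)) - (fresnelCos σ τ 0 - L) * s‖ := by
        congr 1; ring
    _ ≤ 2 * fresnelError τ * (Q + 5 * Q) + fresnelError τ * (2 * (5 * Q)) :=
        (norm_sub_le _ _).trans (add_le_add b1 b2)
    _ = _ := by ring

/-- The Fresnel asymptotics for a function that is close to `cosMultiplier σ * freeTransform`. -/
theorem norm_integral_fresnel_sub_le (hσ : |σ| ≤ 1) (hτ : τ ≠ 0)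
    (h : FastDecay Q w) (h₁ : FastDecay Q w₁) (h₂ : FastDecay Q w₂) {H g : ℝ → ℝ} {ε : ℝ}
    (hH : AEStronglyMeasurable H (volume.restrict (Ioi 0))) (hg : IntegrableOn g (Ioi 0))
    (hgε : ∫ k in Ioi (0 : ℝ), g k ≤ ε)
    (hb : ∀ k, 0 < k → |H k - cosMultiplier σ k * freeTransform w w₁ w₂ k| ≤ g k) :
    IntegrableOn (fun k : ℝ => Complex.exp (I * τ * k ^ 2 / 2) * (H k : ℂ)) (Ioi 0) ∧
    ‖(∫ k in Ioi (0 : ℝ), Complex.exp (I * τ * k ^ 2 / 2) * (H k : ℂ))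
      - ((Real.pi : ℂ) / (-(I * τ / 2))) ^ (1 / 2 : ℂ) / 2 * cosMultiplier σ 0
        * (∫ x in Ioi (0 : ℝ), w x : ℝ)‖ ≤ 22 * fresnelError τ * Q + ε := by
  have hm : AEStronglyMeasurable (freeTransform w w₁ w₂) (volume.restrict (Ioi 0)) :=
    (aestronglyMeasurable_cosTransform (h.add (h.sourceTerm h₁ h₂))).sub
      aestronglyMeasurable_const
  have j0 := integrableOn_cosMultiplier_mul hσ hm (abs_freeTransform_le h h₁ h₂)
  have j1 : IntegrableOn (fun k => H k - cosMultiplier σ k * freeTransform w w₁ w₂ k) (Ioi 0) := by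
    refine hg.mono' (hH.sub j0.aestronglyMeasurable) ?_
    filter_upwards [ae_restrict_mem measurableSet_Ioi] with k hk using hb k hk
  have j2 : IntegrableOn H (Ioi 0) := by
    refine (j1.add j0).congr (.of_forall fun k => ?_)
    simp
  have i0 := integrableOn_fresnel_mul (τ := τ) j0
  have i1 := integrableOn_fresnel_mul (τ := τ) j1
  have i2 := integrableOn_fresnel_mul (τ := τ) j2
  refine ⟨i2, ?_⟩
  have b0 := norm_integral_fresnel_freeTransform_sub_le hσ hτ h h₁ h₂
  have b1 : ‖∫ k in Ioi (0 : ℝ), Complex.exp (I * τ * k ^ 2 / 2)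
      * ((H k - cosMultiplier σ k * freeTransform w w₁ w₂ k : ℝ) : ℂ)‖ ≤ ε := by
    refine (norm_integral_le_of_norm_le hg ?_).trans hgε
    filter_upwards [ae_restrict_mem measurableSet_Ioi] with k hk
    rw [norm_mul, norm_fresnel_phase, one_mul, Complex.norm_real]
    exact hb k hk
  have e : (∫ k in Ioi (0 : ℝ), Complex.exp (I * τ * k ^ 2 / 2) * (H k : ℂ))
      = (∫ k in Ioi (0 : ℝ), Complex.exp (I * τ * k ^ 2 / 2)
        * (cosMultiplier σ k * freeTransform w w₁ w₂ k : ℝ))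
      + ∫ k in Ioi (0 : ℝ), Complex.exp (I * τ * k ^ 2 / 2)
      * ((H k - cosMultiplier σ k * freeTransform w w₁ w₂ k : ℝ) : ℂ) := by
    rw [← integral_add i0 i1]
    congr 1; ext k
    push_cast; ring
  rw [e, add_sub_right_comm]
  exact (norm_add_le _ _).trans (add_le_add b0 b1)

end

/-! ### The dispersive and resonant integrals -/

theorem integrableOn_lorentzian {q : ℝ} (hq : q ≠ 0) :
    IntegrableOn (fun k : ℝ => (1 + (|q|⁻¹ * k) ^ 2)⁻¹) (Ioi 0) :=
  (integrable_inv_one_add_sq.comp_mul_left' (inv_ne_zero (abs_ne_zero.2 hq))).integrableOn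

theorem integral_lorentzian_le {q : ℝ} (hq : q ≠ 0) :
    ∫ k in Ioi (0 : ℝ), (1 + (|q|⁻¹ * k) ^ 2)⁻¹ ≤ 2 * |q| := by
  rw [integral_comp_mul_left_Ioi (fun u : ℝ => (1 + u ^ 2)⁻¹) 0 (inv_pos.2 (abs_pos.2 hq)),
    mul_zero, integral_Ioi_inv_one_add_sq, inv_inv, smul_eq_mul, Real.arctan_zero, sub_zero]
  nlinarith [Real.pi_lt_four, abs_pos.2 hq]

section

variable {q Q : ℝ} {w w₁ w₂ : ℝ → ℝ}

/-- There is no leading term because the multiplier `k²/(1+k²)²` vanishes at `k = 0`. -/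
theorem norm_integral_dispersive_le {τ : ℝ} (hq : |q| < 1 / 2) (hτ : τ ≠ 0)
    (h : FastDecay Q w) (h₁ : FastDecay Q w₁) (h₂ : FastDecay Q w₂)
    (d : ∀ x, 0 < x → HasDerivAt w (w₁ x) x) (d₁ : ∀ x, 0 < x → HasDerivAt w₁ (w₂ x) x) :
    IntegrableOn (fun k : ℝ => Complex.exp (I * τ * k ^ 2 / 2)
      * (k ^ 2 / (1 + k ^ 2) ^ 2 * kernelTransform q w k : ℝ)) (Ioi 0) ∧
    ‖∫ k in Ioi (0 : ℝ), Complex.exp (I * τ * k ^ 2 / 2)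
      * (k ^ 2 / (1 + k ^ 2) ^ 2 * kernelTransform q w k : ℝ)‖
      ≤ 22 * fresnelError τ * Q + 116 * |q| * Q := by
  have hσ : |(-1 : ℝ)| ≤ 1 := by simp
  have hQ := h.nonneg
  have hg : IntegrableOn (fun k : ℝ => 58 * |q| * Q * (1 + k ^ 2)⁻¹) (Ioi 0) :=
    integrable_inv_one_add_sq.integrableOn.const_mul _
  have hm := continuous_cosMultiplier (-1)
  have := norm_integral_fresnel_sub_le hσ hτ h h₁ h₂
    (H := fun k => cosMultiplier (-1) k * kernelTransform q w k) (ε := 116 * |q| * Q)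
    (hm.aestronglyMeasurable.mul (aestronglyMeasurable_kernelTransform q h)) hg
    (by
      rw [integral_const_mul, integral_Ioi_inv_one_add_sq, Real.arctan_zero, sub_zero]
      nlinarith [Real.pi_lt_four, mul_nonneg (abs_nonneg q) hQ])
    (fun k hk => by
      rw [← mul_sub, abs_mul, mul_comm]
      gcongr
      · exact abs_kernelTransform_sub_freeTransform_le hq hk h h₁ h₂ d d₁
      · exact abs_cosMultiplier_le hσ k)
  simpa [cosMultiplier_neg_one] using this

theorem norm_integral_resonant_sub_le {τ : ℝ} (hq0 : q ≠ 0) (hq : |q| < 1 / 2) (hτ : τ ≠ 0)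
    (h : FastDecay Q w) (h₁ : FastDecay Q w₁) (h₂ : FastDecay Q w₂)
    (d : ∀ x, 0 < x → HasDerivAt w (w₁ x) x) (d₁ : ∀ x, 0 < x → HasDerivAt w₁ (w₂ x) x) :
    IntegrableOn (fun k : ℝ => Complex.exp (I * τ * k ^ 2 / 2)
      * ((1 - q ^ 2) * k ^ 2 / (k ^ 2 + q ^ 2) * (kernelTransform q w k / (1 + k ^ 2) ^ 2) : ℝ))
      (Ioi 0) ∧
    ‖(∫ k in Ioi (0 : ℝ), Complex.exp (I * τ * k ^ 2 / 2)
      * ((1 - q ^ 2) * k ^ 2 / (k ^ 2 + q ^ 2) * (kernelTransform q w k / (1 + k ^ 2) ^ 2) : ℝ))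
      - ((Real.pi : ℂ) / (-(I * τ / 2))) ^ (1 / 2 : ℂ) / 2 * (∫ x in Ioi (0 : ℝ), w x : ℝ)‖
      ≤ 22 * fresnelError τ * Q + 160 * |q| * Q := by
  have hσ : |(1 : ℝ)| ≤ 1 := by simp
  have hQ := h.nonneg
  have hqQ := mul_nonneg (abs_nonneg q) hQ
  have hg1 : IntegrableOn (fun k : ℝ => 58 * |q| * Q * (1 + k ^ 2)⁻¹) (Ioi 0) :=
    integrable_inv_one_add_sq.integrableOn.const_mul _
  have hg2 : IntegrableOn (fun k : ℝ => 22 * Q * (1 + (|q|⁻¹ * k) ^ 2)⁻¹) (Ioi 0) :=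
    (integrableOn_lorentzian hq0).const_mul _
  have hmeas : AEStronglyMeasurable (fun k : ℝ => (1 - q ^ 2) * k ^ 2 / (k ^ 2 + q ^ 2)
      * (kernelTransform q w k / (1 + k ^ 2) ^ 2)) (volume.restrict (Ioi 0)) := by
    have h1 : Measurable fun k : ℝ => (1 - q ^ 2) * k ^ 2 / (k ^ 2 + q ^ 2) := by fun_prop
    have h2 : Measurable fun k : ℝ => ((1 + k ^ 2) ^ 2)⁻¹ := by fun_prop
    simp only [div_eq_mul_inv _ ((1 + _ : ℝ) ^ 2)]
    exact h1.aestronglyMeasurable.mul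
      ((aestronglyMeasurable_kernelTransform q h).mul h2.aestronglyMeasurable)
  have hq2 : 0 < q ^ 2 := by positivity
  have hq1 : q ^ 2 ≤ 1 := by
    rw [← sq_abs]; nlinarith [abs_nonneg q]
  have := norm_integral_fresnel_sub_le hσ hτ h h₁ h₂ (ε := 160 * |q| * Q) hmeas (hg1.add hg2)
    (by
      simp only [Pi.add_apply]
      rw [integral_add hg1 hg2, integral_const_mul, integral_const_mul,
        integral_Ioi_inv_one_add_sq, Real.arctan_zero, sub_zero]
      have h1 := mul_le_mul_of_nonneg_left (integral_lorentzian_le hq0)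
        (by positivity : 0 ≤ 22 * Q)
      nlinarith [Real.pi_lt_four])
    (fun k hk => by
      have hk2 : 0 < k ^ 2 + q ^ 2 := by positivity
      have hr : 0 < 1 + k ^ 2 := by positivity
      -- The error splits into `ρ` times the error of the transform, and `1 - ρ = q²(1+k²)/(k²+q²)`
      -- times the bounded free transform. After division by `(1+k²)²` the latter weight is at most
      -- the Lorentzian `q²/(k²+q²)`, whose integral is `O(q)`. The total is `160 = 58·2 + 22·2`.
      set ρ := (1 - q ^ 2) * k ^ 2 / (k ^ 2 + q ^ 2) with hρ
      have hρ0 : 0 ≤ ρ := div_nonneg (mul_nonneg (by linarith) (sq_nonneg k)) hk2.le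
      have hρ1 : 1 - ρ = q ^ 2 * (1 + k ^ 2) / (k ^ 2 + q ^ 2) := by
        rw [hρ]; field_simp; ring
      have hρ2 : 0 ≤ 1 - ρ := by rw [hρ1]; positivity
      have b1 := abs_kernelTransform_sub_freeTransform_le hq hk h h₁ h₂ d d₁
      have b2 := abs_freeTransform_le h h₁ h₂ k
      have e : ρ * (kernelTransform q w k / (1 + k ^ 2) ^ 2)
          - cosMultiplier 1 k * freeTransform w w₁ w₂ k
          = ρ * (1 / (1 + k ^ 2) ^ 2) * (kernelTransform q w k - freeTransform w w₁ w₂ k)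
            - (1 - ρ) * (1 / (1 + k ^ 2) ^ 2) * freeTransform w w₁ w₂ k := by
        rw [cosMultiplier_one]; ring
      have e2 : (1 - ρ) * (1 / (1 + k ^ 2) ^ 2) ≤ (1 + (|q|⁻¹ * k) ^ 2)⁻¹ := by
        have : (1 + (|q|⁻¹ * k) ^ 2)⁻¹ = q ^ 2 / (k ^ 2 + q ^ 2) := by
          rw [mul_pow, inv_pow, sq_abs]
          field_simp
          ring
        rw [this, hρ1]
        calc q ^ 2 * (1 + k ^ 2) / (k ^ 2 + q ^ 2) * (1 / (1 + k ^ 2) ^ 2)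
            = q ^ 2 / (k ^ 2 + q ^ 2) * (1 + k ^ 2)⁻¹ := by field_simp
          _ ≤ q ^ 2 / (k ^ 2 + q ^ 2) :=
            mul_le_of_le_one_right (by positivity)
              (inv_le_one_of_one_le₀ (by nlinarith [sq_nonneg k]))
      have e1 : ρ * (1 / (1 + k ^ 2) ^ 2) ≤ (1 + k ^ 2)⁻¹ :=
        (mul_le_of_le_one_left (by positivity) (by linarith)).trans (one_div_sq_le_inv k)
      rw [e]
      refine (abs_sub _ _).trans ?_
      rw [abs_mul, abs_mul _ (freeTransform w w₁ w₂ k), abs_of_nonneg (mul_nonneg hρ0 (by positivity)),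
        abs_of_nonneg (mul_nonneg hρ2 (by positivity)), mul_comm,
        mul_comm _ |freeTransform w w₁ w₂ k|]
      simp only [Pi.add_apply]
      gcongr)
  simpa [cosMultiplier_one] using this

theorem wZero_asymptotics {t : ℝ} (hq0 : q ≠ 0) (hq : |q| < 1 / 2) (ht : 0 < t)
    (h : FastDecay Q w) (h₁ : FastDecay Q w₁) (h₂ : FastDecay Q w₂)
    (d : ∀ x, 0 < x → HasDerivAt w (w₁ x) x) (d₁ : ∀ x, 0 < x → HasDerivAt w₁ (w₂ x) x) :
    IntegrableOn (waveIntegrand q w t) (Ioi 0) ∧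
    ‖wZero q w t + 2 / Real.pi * (Complex.exp (I * t / 2)
      * (√(2 * Real.pi / t) * Complex.exp (I * Real.pi / 4) / 2 * (∫ x in Ioi (0 : ℝ), w x : ℝ)))‖
      ≤ 44 * fresnelError t * Q + 276 * |q| * Q := by
  obtain ⟨i1, b1⟩ := norm_integral_dispersive_le hq (neg_ne_zero.2 ht.ne') h h₁ h₂ d d₁
  obtain ⟨i2, b2⟩ := norm_integral_resonant_sub_le hq0 hq ht.ne' h h₁ h₂ d d₁
  have hft : fresnelError (-t) = fresnelError t := by simp [fresnelError]
  rw [fresnel_const ht] at b2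
  rw [hft] at b1
  have hE : EqOn (waveIntegrand q w t) _ (Ioi 0) := fun k hk =>
    waveIntegrand_eq w t (hq.trans (by norm_num)) (mem_Ioi.1 hk)
  have i3 := ((i1.const_mul (Complex.exp (-(I * t / 2)))).add
    (i2.const_mul (Complex.exp (I * t / 2)))).const_mul (-(2 / √(2 * Real.pi) : ℂ))
  refine ⟨IntegrableOn.congr_fun i3 hE.symm measurableSet_Ioi, ?_⟩
  have hpi := Real.pi_pos
  have hc : (√(2 / Real.pi) : ℂ) * -(2 / √(2 * Real.pi)) = -(2 / Real.pi) := by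
    have : √(2 / Real.pi) * (2 / √(2 * Real.pi)) = 2 / Real.pi := by
      rw [mul_div_left_comm, ← Real.sqrt_div (by positivity),
        show 2 / Real.pi / (2 * Real.pi) = (1 / Real.pi) ^ 2 by field_simp,
        Real.sqrt_sq (by positivity)]
      ring
    rw [mul_neg]
    exact_mod_cast congrArg (fun z : ℝ => -(z : ℂ)) this
  rw [wZero, setIntegral_congr_fun measurableSet_Ioi hE, integral_const_mul, ← mul_assoc, hc,
    integral_add (i1.const_mul _) (i2.const_mul _), integral_const_mul, integral_const_mul]
  set J1 := ∫ k in Ioi (0 : ℝ), Complex.exp (I * ((-t : ℝ) : ℂ) * k ^ 2 / 2)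
    * (k ^ 2 / (1 + k ^ 2) ^ 2 * kernelTransform q w k : ℝ)
  set J2 := ∫ k in Ioi (0 : ℝ), Complex.exp (I * t * k ^ 2 / 2)
    * ((1 - q ^ 2) * k ^ 2 / (k ^ 2 + q ^ 2) * (kernelTransform q w k / (1 + k ^ 2) ^ 2) : ℝ)
  set m := (√(2 * Real.pi / t) * Complex.exp (I * Real.pi / 4) / 2
    * (∫ x in Ioi (0 : ℝ), w x : ℝ) : ℂ)
  have e : -(2 / Real.pi : ℂ) * (Complex.exp (-(I * t / 2)) * J1 + Complex.exp (I * t / 2) * J2)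
      + 2 / Real.pi * (Complex.exp (I * t / 2) * m)
      = -(2 / Real.pi : ℂ) * (Complex.exp (-(I * t / 2)) * J1
        + Complex.exp (I * t / 2) * (J2 - m)) := by ring
  have n1 : ‖Complex.exp (-(I * t / 2))‖ = 1 := by rw [Complex.norm_exp]; simp
  have n2 : ‖Complex.exp (I * t / 2)‖ = 1 := by rw [Complex.norm_exp]; simp
  have n3 : ‖-(2 / Real.pi : ℂ)‖ ≤ 1 := by
    rw [norm_neg, norm_div, Complex.norm_real, Real.norm_eq_abs, abs_of_pos hpi, div_le_one hpi]
    simpa using Real.two_le_pi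
  rw [e, norm_mul]
  refine (mul_le_of_le_one_left (norm_nonneg _) n3).trans ((norm_add_le _ _).trans ?_)
  rw [norm_mul, norm_mul, n1, n2]
  linarith

end

/-! ### Admissible data and the conclusion -/

/-- The constant comes from expanding `(1 + x²)² = 1 + 2x² + x⁴`. -/
theorem Admissible.fastDecay {C : ℕ → ℕ → ℝ} {q : ℝ} {w : ℝ → ℝ} (h : Admissible C q w) (l : ℕ) :
    FastDecay ((|C 0 l| + 2 * |C 2 l| + |C 4 l|) * |q|) (iteratedDeriv l w) := by
  constructor
  · have h1 := h.smooth.continuousOn_iteratedDerivWithin (m := l) (by exact_mod_cast le_top)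
      (uniqueDiffOn_Ioi 0)
    exact h1.congr fun x hx => (iteratedDerivWithin_of_isOpen isOpen_Ioi hx).symm
  · intro x hx
    have h0 := h.bound 0 l x hx
    have h2 := h.bound 2 l x hx
    have h4 := h.bound 4 l x hx
    have a0 := mul_le_mul_of_nonneg_right (le_abs_self (C 0 l)) (abs_nonneg q)
    have a2 := mul_le_mul_of_nonneg_right (le_abs_self (C 2 l)) (abs_nonneg q)
    have a4 := mul_le_mul_of_nonneg_right (le_abs_self (C 4 l)) (abs_nonneg q)
    rw [abs_mul, abs_of_pos (pow_pos hx _)] at h0 h2 h4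
    rw [mul_one_div, le_div_iff₀ (by positivity)]
    nlinarith

theorem Admissible.hasDerivAt {C : ℕ → ℕ → ℝ} {q : ℝ} {w : ℝ → ℝ} (h : Admissible C q w) (l : ℕ)
    {x : ℝ} (hx : 0 < x) :
    HasDerivAt (iteratedDeriv l w) (iteratedDeriv (l + 1) w x) x := by
  have h1 := h.smooth.differentiableOn_iteratedDerivWithin (m := l)
    (by exact_mod_cast WithTop.coe_lt_top l) (uniqueDiffOn_Ioi 0)
  have h2 : DifferentiableAt ℝ (iteratedDeriv l w) x :=
    (h1.congr fun y hy => (iteratedDerivWithin_of_isOpen isOpen_Ioi hy).symm).differentiableAt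
      (Ioi_mem_nhds hx)
  rw [iteratedDeriv_succ]
  exact h2.hasDerivAt

theorem Admissible.integrable {C : ℕ → ℕ → ℝ} {q : ℝ} {w : ℝ → ℝ} (h : Admissible C q w) :
    Integrable w ∧ ∫ x, w x = 2 * ∫ x in Ioi (0 : ℝ), w x := by
  have h0 : IntegrableOn w (Ioi 0) := by simpa using (h.fastDecay 0).integrableOn
  have he : ∀ x, w |x| = w x := fun x => by
    rcases abs_cases x with ⟨e, -⟩ | ⟨e, -⟩ <;> simp [e, h.even]
  constructor
  · have hI : IntegrableOn w (Iic 0) := by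
      have m : MeasurableEmbedding fun x : ℝ => -x := (Homeomorph.neg ℝ).measurableEmbedding
      rw [← Measure.map_neg_eq_self (volume : Measure ℝ), m.integrableOn_map_iff]
      simp_rw [Function.comp_def, h.even, neg_preimage, neg_Iic, neg_zero]
      exact Iff.mpr integrableOn_Ici_iff_integrableOn_Ioi h0
    rw [← integrableOn_univ, ← Iic_union_Ioi (a := (0 : ℝ))]
    exact hI.union h0
  · have := integral_comp_abs (f := w)
    simpa only [he] using this

end DeltaNLS

theorem mainTheorem6 :
    ∃ q₀ : ℝ, 0 < q₀ ∧ q₀ < 1 ∧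
      ∀ C : ℕ → ℕ → ℝ, ∃ K : ℝ, 0 < K ∧
        ∀ q : ℝ, 0 < |q| → |q| < q₀ →
          ∀ w₀ : ℝ → ℝ, DeltaNLS.Admissible C q w₀ →
            Integrable w₀ ∧
            (∀ k : ℝ, 0 < k →
              IntegrableOn (DeltaNLS.transformIntegrand q w₀ k) (Ioi 0)) ∧
            ∀ t : ℝ, 1 ≤ t →
              IntegrableOn (DeltaNLS.waveIntegrand q w₀ t) (Ioi 0) ∧
              ‖DeltaNLS.wZero q w₀ t
                  - -((1 / √(2 * Real.pi * t) : ℝ)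
                    * Complex.exp (Complex.I * t / 2 + Complex.I * Real.pi / 4)
                    * ((∫ x, w₀ x : ℝ) : ℂ))‖
                ≤ K * (|q| / t ^ (3 / 2 : ℝ) + q ^ 2) := by
  -- The threshold `1/2` is what `abs_tanh_add_theta_sub_le` needs to keep `1 + q tanh x` away from
  -- `0`.
  refine ⟨1 / 2, by norm_num, by norm_num, fun C => ?_⟩
  set c : ℕ → ℝ := fun l => |C 0 l| + 2 * |C 2 l| + |C 4 l| with hc
  have hc0 : ∀ l, 0 ≤ c l := fun l => by simp only [hc]; positivity
  set M := c 0 + c 1 + c 2 with hM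
  have hM0 : 0 ≤ M := by have := hc0 0; have := hc0 1; have := hc0 2; positivity
  -- Here `264000 = 44·6000`, with `6000 = 2000·3` from `√(2π) ≤ 3`; the summand `1` keeps the
  -- constant positive when `M = 0`.
  refine ⟨264000 * M + 1, by positivity, fun q hq0 hq w hw => ?_⟩
  have hqne : q ≠ 0 := abs_pos.1 hq0
  have hF : ∀ l, c l ≤ M → DeltaNLS.FastDecay (M * |q|) (iteratedDeriv l w) := fun l hl =>
    ⟨(hw.fastDecay l).cont, fun x hx => ((hw.fastDecay l).bound x hx).trans (by gcongr)⟩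
  have h := hF 0 (by linarith [hc0 1, hc0 2])
  have h₁ := hF 1 (by linarith [hc0 0, hc0 2])
  have h₂ := hF 2 (by linarith [hc0 0, hc0 1])
  rw [iteratedDeriv_zero] at h
  have d : ∀ x, 0 < x → HasDerivAt w (iteratedDeriv 1 w x) x := fun x hx => by
    simpa using hw.hasDerivAt 0 hx
  obtain ⟨hwi, hwe⟩ := hw.integrable
  refine ⟨hwi, fun k hk => ?_, fun t ht => ?_⟩
  · refine IntegrableOn.congr_fun (((DeltaNLS.integrableOn_kernel_mul (q := q) hk h).ofReal
      (𝕜 := ℂ)).const_mul (starRingEnd ℂ (DeltaNLS.evenFactor q k) * k)) (fun x hx => ?_)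
      measurableSet_Ioi
    exact (DeltaNLS.transformIntegrand_eq w (hq.trans (by norm_num)) hk (mem_Ioi.1 hx).le).symm
  · have ht0 : 0 < t := one_pos.trans_le ht
    have hpi := Real.pi_pos
    obtain ⟨hi, hb⟩ := DeltaNLS.wZero_asymptotics hqne hq ht0 h h₁ h₂ d
      (fun x hx => hw.hasDerivAt 1 hx)
    refine ⟨hi, ?_⟩
    -- The factor `2` on the right turns the half-line integral of the even `w` into the integral
    -- over the whole line.
    have hs : 2 / Real.pi * (√(2 * Real.pi / t) / 2) = 1 / √(2 * Real.pi * t) * 2 := by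
      have e : 2 * Real.pi / t = (2 * Real.pi) ^ 2 / (2 * Real.pi * t) := by field_simp
      rw [e, Real.sqrt_div (by positivity), Real.sqrt_sq (by positivity)]
      field_simp
    have hm : (2 / Real.pi * (Complex.exp (Complex.I * t / 2) * (√(2 * Real.pi / t)
        * Complex.exp (Complex.I * Real.pi / 4) / 2 * (∫ x in Ioi (0 : ℝ), w x : ℝ))) : ℂ)
        = (1 / √(2 * Real.pi * t) : ℝ)
          * Complex.exp (Complex.I * t / 2 + Complex.I * Real.pi / 4)
          * ((∫ x, w x : ℝ) : ℂ) := by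
      have hs' : (2 / Real.pi * (√(2 * Real.pi / t) / 2) : ℂ)
          = (1 / √(2 * Real.pi * t) : ℝ) * 2 := by exact_mod_cast hs
      rw [Complex.exp_add, hwe, Complex.ofReal_mul, Complex.ofReal_ofNat]
      linear_combination Complex.exp (Complex.I * t / 2) * Complex.exp (Complex.I * Real.pi / 4)
        * (∫ x in Ioi (0 : ℝ), w x : ℝ) * hs'
    rw [sub_neg_eq_add, ← hm]
    refine hb.trans ?_
    have ht32 : t ^ (3 / 2 : ℝ) = √t * t := by
      rw [Real.sqrt_eq_rpow, ← Real.rpow_add_one ht0.ne']; norm_num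
    have hfe : DeltaNLS.fresnelError t ≤ 6000 * (1 / t ^ (3 / 2 : ℝ)) := by
      have hs3 : √(2 * Real.pi) ≤ 3 := by
        rw [Real.sqrt_le_left (by norm_num)]; linarith [Real.pi_lt_four]
      rw [DeltaNLS.fresnelError, abs_of_pos ht0, Real.sqrt_div (by positivity), ht32]
      have hst := Real.sqrt_pos.2 ht0
      rw [show 2000 * (√(2 * Real.pi) / √t) / t = 2000 * √(2 * Real.pi) * (1 / (√t * t)) by
        field_simp]
      gcongr
      linarith
    have hqq : |q| * (M * |q|) = M * q ^ 2 := by rw [← sq_abs q]; ring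
    have hdiv : |q| / t ^ (3 / 2 : ℝ) = |q| * (1 / t ^ (3 / 2 : ℝ)) := by ring
    have hp : 0 ≤ 1 / t ^ (3 / 2 : ℝ) := by positivity
    rw [hdiv]
    calc 44 * DeltaNLS.fresnelError t * (M * |q|) + 276 * |q| * (M * |q|)
        ≤ 44 * (6000 * (1 / t ^ (3 / 2 : ℝ))) * (M * |q|) + 276 * (M * q ^ 2) := by
          rw [mul_assoc 276, hqq]
          gcongr
      _ = 264000 * M * (|q| * (1 / t ^ (3 / 2 : ℝ))) + 276 * M * q ^ 2 := by ring
      _ ≤ (264000 * M + 1) * (|q| * (1 / t ^ (3 / 2 : ℝ))) + (264000 * M + 1) * q ^ 2 := by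
          gcongr <;> linarith
      _ = _ := by ring
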